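/- Let $k\ge 1$ be an integer, $\rho>0$, and let $B^{k+1}_\rho=\{m\in\mathbb R^{k+1}:|m|<\rho\}$ be the ball model of the hyperbolic space of constant sectional curvature $-1/\rho^2$, with metric $2\rho^2|ds|/(\rho^2-|m|^2)$, hyperbolic distance $d$ and Laplace--Beltrami operator $\triangle$. Fix $u\in\mathbb R^{k+1}$ with $|u|=\rho$ and $\alpha\in\mathbb C$, put $$\omega(u,m)=\frac{|u|^2-|m|^2}{|u-m|^2},\qquad V_\alpha(\eta)=\frac{1}{|S(\eta)|}\int_{S(\eta)}\omega^\alpha(u,m)\,dS_m\quad(0<\eta<\rho),\qquad V_\alpha(0)=\omega^\alpha(u,0),$$ where $S(\eta)$ is the Euclidean sphere of radius $\eta$ centered at the origin $O$ and $dS$ is its Euclidean surface measure, and let $$\mu=\frac{\alpha k-\alpha^2}{\rho^2},\qquad \varphi_\mu(r)=V_\alpha\!\left(\rho\tanh\frac{r}{2\rho}\right)\quad(r\ge 0).$$ Then: 1. for every $m\in B^{k+1}_\rho$, the hyperbolic distance $r=d(O,m)$ satisfies $|m|=\rho\tanh(r/(2\rho))$, so that $\varphi_\mu(r)=V_\alpha(|m|)$;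 2. $\varphi_\mu$ is a radial eigenfunction with eigenvalue $\mu$ and value $1$ at the origin: the function $m\mapsto\varphi_\mu(d(O,m))$ is of class $C^2$ on $B^{k+1}_\rho$ and satisfies there $\triangle\varphi_\mu+\mu\varphi_\mu=0$, and $\varphi_\mu(0)=1$; 3. it is the only one: if $\psi:[0,\infty)\to\mathbb C$ is such that $m\mapsto\psi(d(O,m))$ is of class $C^2$ on $B^{k+1}_\rho$ and satisfies $\triangle\psi+\mu\psi=0$ there, and $\psi(0)=1$, then $\psi(r)=\varphi_\mu(r)$ for all $r\ge0$. The same holds if $m\mapsto\psi(d(O,m))$ is only required to be of class $C^2$ and to satisfy the equation on $B^{k+1}_\rho\setminus\{O\}$, provided that $\psi$ is continuous at $0$ with $\psi(0)=1$. -/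

import Mathlib

open MeasureTheory Set Metric

namespace HypBall

noncomputable section

/-- The `i`-th partial derivative of a complex-valued function on `ℝⁿ`. -/
def partialDeriv {n : ℕ} (i : Fin n) (f : EuclideanSpace ℝ (Fin n) → ℂ)
    (x : EuclideanSpace ℝ (Fin n)) : ℂ :=
  fderiv ℝ f x (EuclideanSpace.single i 1)

/-- The Laplace–Beltrami operator of a Riemannian metric `g = (g_{ij})` given on an open subset
of `ℝⁿ`: `Δ f = |g|^{-1/2} ∑ᵢ ∂ᵢ (|g|^{1/2} ∑ⱼ g^{ij} ∂ⱼ f)`. -/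
def laplaceBeltrami {n : ℕ} (g : EuclideanSpace ℝ (Fin n) → Matrix (Fin n) (Fin n) ℝ)
    (f : EuclideanSpace ℝ (Fin n) → ℂ) (x : EuclideanSpace ℝ (Fin n)) : ℂ :=
  (√(g x).det)⁻¹ •
    ∑ i, partialDeriv i (fun y => √(g y).det • ∑ j, (g y)⁻¹ i j • partialDeriv j f y) x

/-- The length of a path `γ : [0, 1] → ℝⁿ` with respect to a Riemannian metric `g`. -/
def pathLength {n : ℕ} (g : EuclideanSpace ℝ (Fin n) → Matrix (Fin n) (Fin n) ℝ)
    (γ : ℝ → EuclideanSpace ℝ (Fin n)) : ℝ :=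
  ∫ t in (0 : ℝ)..1,
    √((derivWithin γ (Icc 0 1) t).ofLp ⬝ᵥ ((g (γ t)).mulVec (derivWithin γ (Icc 0 1) t).ofLp))

/-- The Riemannian distance of `x` and `y` in a domain `Ω` with the metric `g`: the infimum of the
lengths of the `C¹` paths in `Ω` from `x` to `y`. -/
def riemDist {n : ℕ} (Ω : Set (EuclideanSpace ℝ (Fin n)))
    (g : EuclideanSpace ℝ (Fin n) → Matrix (Fin n) (Fin n) ℝ)
    (x y : EuclideanSpace ℝ (Fin n)) : ℝ :=
  sInf {L | ∃ γ : ℝ → EuclideanSpace ℝ (Fin n), ContDiffOn ℝ 1 γ (Icc 0 1) ∧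
    MapsTo γ (Icc 0 1) Ω ∧ γ 0 = x ∧ γ 1 = y ∧ L = pathLength g γ}

/-- The metric `2 ρ² |ds| / (ρ² - |x|²)` of the ball model (the ball `|x| < ρ`) of the hyperbolic
space of constant sectional curvature `-1/ρ²`. -/
def ballMetric {n : ℕ} (ρ : ℝ) (x : EuclideanSpace ℝ (Fin n)) : Matrix (Fin n) (Fin n) ℝ :=
  (2 * ρ ^ 2 / (ρ ^ 2 - ‖x‖ ^ 2)) ^ 2 • (1 : Matrix (Fin n) (Fin n) ℝ)

/-- The hyperbolic Laplacian in the ball model. -/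
def hypLaplacian {n : ℕ} (ρ : ℝ) (f : EuclideanSpace ℝ (Fin n) → ℂ)
    (x : EuclideanSpace ℝ (Fin n)) : ℂ :=
  laplaceBeltrami (ballMetric ρ) f x

/-- The hyperbolic distance in the ball model. -/
def hypDist {n : ℕ} (ρ : ℝ) (x y : EuclideanSpace ℝ (Fin n)) : ℝ :=
  riemDist (ball 0 ρ) (ballMetric ρ) x y

/-- The surface measure of the Euclidean sphere `|x| = η` in `ℝ^{k+1}`, for `η > 0`, as a measure
on `ℝ^{k+1}`: the surface measure of the unit sphere, transported by `θ ↦ η θ` and multiplied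
by `η ^ k`. -/
def sphereMeasure (k : ℕ) (η : ℝ) : Measure (EuclideanSpace ℝ (Fin (k + 1))) :=
  ENNReal.ofReal (η ^ k) •
    Measure.map (fun θ : sphere (0 : EuclideanSpace ℝ (Fin (k + 1))) 1 =>
        η • (θ : EuclideanSpace ℝ (Fin (k + 1))))
      (volume : Measure (EuclideanSpace ℝ (Fin (k + 1)))).toSphere

/-- The mean of `f` over the sphere `|x| = η`; for `η = 0` the sphere is the origin.
The radialization of `f` about the origin is `m ↦ sphericalMean k f ‖m‖`. -/
def sphericalMean (k : ℕ) (f : EuclideanSpace ℝ (Fin (k + 1)) → ℂ) (η : ℝ) : ℂ :=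
  if η = 0 then f 0
  else ((sphereMeasure k η).real univ)⁻¹ • ∫ m, f m ∂(sphereMeasure k η)

/-- `ω(u, m) = (|u|² - |m|²) / |u - m|²`. -/
def omega {n : ℕ} (u m : EuclideanSpace ℝ (Fin n)) : ℝ :=
  (‖u‖ ^ 2 - ‖m‖ ^ 2) / ‖u - m‖ ^ 2

/-- `V_α(η)`: the radialization of `ω^α(u, ·)` on the sphere `|m| = η`. -/
def V (k : ℕ) (u : EuclideanSpace ℝ (Fin (k + 1))) (α : ℂ) (η : ℝ) : ℂ :=
  sphericalMean k (fun m => (omega u m : ℂ) ^ α) η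

/-- The function of the hyperbolic distance `r` from the origin given by `φ`, that is
`m ↦ φ (d(O, m))`, is of class `C²` on the open subset `Ω` of the ball model of dimension `k + 1`
and satisfies `Δ φ + μ φ = 0` there. -/
def IsRadialEigenfunctionOn (k : ℕ) (ρ : ℝ) (μ : ℂ)
    (Ω : Set (EuclideanSpace ℝ (Fin (k + 1)))) (φ : ℝ → ℂ) : Prop :=
  ContDiffOn ℝ 2 (fun m : EuclideanSpace ℝ (Fin (k + 1)) => φ (hypDist ρ 0 m)) Ω ∧
    ∀ m ∈ Ω, hypLaplacian ρ (fun x => φ (hypDist ρ 0 x)) m + μ * φ (hypDist ρ 0 m) = 0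

end

end HypBall

namespace HypBall

open Filter Topology

/-! The distance from the centre is `2ρ artanh(|m|/ρ)` (`hypDist_zero_left`): projecting a path onto
the direction of its endpoint does not increase its length, so radial segments are shortest.
Functions of `d(O, m)` thereby become functions of `|m|`.

Existence. For `|v| = ρ` the function `log ω(v, ·)` has constant hyperbolic Laplacian and a
hyperbolic gradient of constant length, so every power `ω^α(v, ·)` is an eigenfunction with
eigenvalue `μ` (`hypLaplacian_omega_cpow`). A reflection swapping `u/ρ` and `m/|m|` turns
`V_α(|m|)`, a mean over the sphere through `m` with `u` fixed, into a mean over `|v| = ρ` with `m`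
fixed (`V_norm`). The integrand is now smooth in `m`, also at `O`, and the Laplacian passes under
the integral (`hypLaplacian_integral`).

Uniqueness. A radial eigenfunction `g(|m|)` solves `(w g')' + q g = 0` on `(0, ρ)`, where `w`
vanishes like `t^k` at `0` (`hasDerivAt_radialWeight_smul_deriv`). For two solutions `g`, `v`
tending to `1`, the weighted Wronskian is a constant `C`, and `(g/v)' = C/(w v²)` near `0`. As `w =
O(t)`, a nonzero `C` would make `g/v` diverge at least logarithmically. Hence `C = 0`, `g = v` near
`0`, and uniqueness for the regular equation extends this to `(0, ρ)` (`sturmLiouville_unique`).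
Only the limit at `0` enters, so the puncture does no harm. -/

/-! ### Hyperbolic distance from the centre. -/

theorem hasDerivAt_two_mul_artanh_div {ρ s : ℝ} (hs : |s| < ρ) :
    HasDerivAt (fun s => 2 * ρ * Real.artanh (s / ρ)) (2 * ρ ^ 2 / (ρ ^ 2 - s ^ 2)) s := by
  have hρ : 0 < ρ := (abs_nonneg s).trans_lt hs
  obtain ⟨h1, h2⟩ := abs_lt.1 hs
  have hd : HasDerivAt (fun s => ρ * (Real.log (ρ + s) - Real.log (ρ - s)))
      (ρ * (1 / (ρ + s) - (-1) / (ρ - s))) s :=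
    ((((hasDerivAt_id s).const_add ρ).log (by simpa using by linarith)).sub
      (((hasDerivAt_id s).const_sub ρ).log (by simpa using by linarith))).const_mul ρ
  have h3 : ρ + s ≠ 0 := by linarith
  have h4 : ρ - s ≠ 0 := by linarith
  have h5 : ρ ^ 2 - s ^ 2 ≠ 0 := by
    rw [sq_sub_sq]; exact mul_ne_zero h3 h4
  have he : 2 * ρ ^ 2 / (ρ ^ 2 - s ^ 2) = ρ * (1 / (ρ + s) - (-1) / (ρ - s)) := by
    field_simp; ring
  rw [he]
  refine hd.congr_of_eventuallyEq ?_
  filter_upwards [Ioo_mem_nhds h1 h2] with t ht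
  have h6 : 0 < ρ + t := by linarith [ht.1]
  have h7 : 0 < ρ - t := by linarith [ht.2]
  rw [Real.artanh_eq_half_log ⟨by rw [le_div_iff₀ hρ]; linarith, by rw [div_le_one hρ]; linarith⟩,
    ← Real.log_div h6.ne' h7.ne']
  have : (1 + t / ρ) / (1 - t / ρ) = (ρ + t) / (ρ - t) := by
    field_simp
  rw [this]; ring

theorem sqrt_ballMetric_apply {n : ℕ} {ρ : ℝ} {x : EuclideanSpace ℝ (Fin n)}
    (hx : x ∈ ball 0 ρ) (v : EuclideanSpace ℝ (Fin n)) :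
    √(v.ofLp ⬝ᵥ ((ballMetric ρ x).mulVec v.ofLp)) = 2 * ρ ^ 2 / (ρ ^ 2 - ‖x‖ ^ 2) * ‖v‖ := by
  have hx' : ‖x‖ < ρ := by simpa using hx
  have hp : 0 < ρ ^ 2 - ‖x‖ ^ 2 := by nlinarith [norm_nonneg x]
  have hv : v.ofLp ⬝ᵥ v.ofLp = ‖v‖ ^ 2 := by
    rw [EuclideanSpace.norm_sq_eq]; simp [dotProduct, sq]
  rw [ballMetric, Matrix.smul_mulVec, Matrix.one_mulVec, dotProduct_smul, hv, smul_eq_mul,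
    ← mul_pow, Real.sqrt_sq (by positivity)]

/-- The radial segment attains the infimum. For any other path `γ`, the coordinate `⟨e, γ⟩` along
the direction `e` of `m` satisfies `|⟨e, γ⟩| ≤ |γ|`, and the metric density increases with the
radius; so the length dominates the integral of the derivative of `2ρ artanh(⟨e, γ⟩/ρ)`. The
coordinate is used instead of `|γ|` because the norm may fail to be differentiable where `γ` meets
the origin. -/
theorem hypDist_zero_left {n : ℕ} {ρ : ℝ} {m : EuclideanSpace ℝ (Fin n)} (hm : m ∈ ball 0 ρ) :
    hypDist ρ 0 m = 2 * ρ * Real.artanh (‖m‖ / ρ) := by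
  have hm' : ‖m‖ < ρ := by simpa using hm
  have hρ : 0 < ρ := (norm_nonneg m).trans_lt hm'
  have hpos : ∀ s : ℝ, |s| < ρ → 0 < ρ ^ 2 - s ^ 2 := fun s hs => by
    nlinarith [sq_abs s, abs_nonneg s]
  refine IsLeast.csInf_eq ⟨⟨fun t => t • m, by fun_prop, ?_, by simp, by simp, ?_⟩, ?_⟩
  · intro t ht
    have : |t| * ‖m‖ ≤ ‖m‖ := by
      rw [abs_of_nonneg ht.1]; exact mul_le_of_le_one_left (norm_nonneg m) ht.2
    simpa [norm_smul] using this.trans_lt hm'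
  · have hlt : ∀ t ∈ Icc (0 : ℝ) 1, |t * ‖m‖| < ρ := fun t ht => by
      rw [abs_of_nonneg (mul_nonneg ht.1 (norm_nonneg m))]
      exact (mul_le_of_le_one_left (norm_nonneg m) ht.2).trans_lt hm'
    have hlen : pathLength (ballMetric ρ) (fun t => t • m) =
        ∫ t in (0 : ℝ)..1, 2 * ρ ^ 2 / (ρ ^ 2 - (t * ‖m‖) ^ 2) * ‖m‖ := by
      refine intervalIntegral.integral_congr fun t ht => ?_
      rw [uIcc_of_le zero_le_one] at ht
      have hd : derivWithin (fun t : ℝ => t • m) (Icc 0 1) t = m := by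
        have := ((hasDerivAt_id t).smul_const m).hasDerivWithinAt (s := Icc 0 1)
        simpa using this.derivWithin (uniqueDiffOn_Icc zero_lt_one t ht)
      have hb : t • m ∈ ball (0 : EuclideanSpace ℝ (Fin n)) ρ := by
        simpa [norm_smul, abs_mul] using hlt t ht
      simp only [hd]
      rw [sqrt_ballMetric_apply hb, norm_smul, Real.norm_eq_abs, mul_pow, mul_pow, sq_abs]
    have hder : ∀ t ∈ Icc (0 : ℝ) 1,
        HasDerivAt (fun t => 2 * ρ * Real.artanh (t * ‖m‖ / ρ))
          (2 * ρ ^ 2 / (ρ ^ 2 - (t * ‖m‖) ^ 2) * ‖m‖) t := fun t ht => by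
      have := (hasDerivAt_two_mul_artanh_div (hlt t ht)).comp t
        ((hasDerivAt_id t).mul_const ‖m‖)
      simpa [Function.comp_def] using this
    rw [hlen, intervalIntegral.integral_eq_sub_of_hasDerivAt
      (f := fun t => 2 * ρ * Real.artanh (t * ‖m‖ / ρ))
      (fun t ht => hder t (by rwa [uIcc_of_le zero_le_one] at ht))]
    · simp
    · refine ContinuousOn.intervalIntegrable ?_
      rw [uIcc_of_le zero_le_one]
      refine ContinuousOn.mul (ContinuousOn.div (by fun_prop) (by fun_prop)
        fun t ht => (hpos _ (hlt t ht)).ne') (by fun_prop)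
  · rintro L ⟨γ, hγ, hmaps, h0, h1, rfl⟩
    -- Only `‖e‖ ≤ 1` is asked for, so that `e = 0` serves when `m = 0`.
    obtain ⟨e, he, hme⟩ : ∃ e : EuclideanSpace ℝ (Fin n), ‖e‖ ≤ 1 ∧ inner ℝ e m = ‖m‖ := by
      refine ⟨‖m‖⁻¹ • m, ?_, ?_⟩
      · rw [norm_smul, norm_inv, norm_norm]; exact inv_mul_le_one
      · rcases eq_or_ne m 0 with rfl | h
        · simp
        · have : ‖m‖ ≠ 0 := norm_ne_zero_iff.2 h
          rw [real_inner_smul_left, real_inner_self_eq_norm_sq]; field_simp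
    set D := fun t => derivWithin γ (Icc 0 1) t with hD
    have hle : ∀ v : EuclideanSpace ℝ (Fin n), |inner ℝ e v| ≤ ‖v‖ := fun v =>
      (abs_real_inner_le_norm e v).trans (mul_le_of_le_one_left (norm_nonneg v) he)
    have hγb : ∀ t ∈ Icc (0 : ℝ) 1, ‖γ t‖ < ρ := fun t ht => by simpa using hmaps ht
    have hlt : ∀ t ∈ Icc (0 : ℝ) 1, |inner ℝ e (γ t)| < ρ := fun t ht =>
      (hle _).trans_lt (hγb t ht)
    have hγc : ContinuousOn γ (Icc 0 1) := hγ.continuousOn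
    have hDc : ContinuousOn D (Icc 0 1) :=
      hγ.continuousOn_derivWithin (uniqueDiffOn_Icc zero_lt_one) le_rfl
    have hic : ContinuousOn (fun t => (inner ℝ e (γ t) : ℝ)) (Icc 0 1) :=
      continuousOn_const.inner hγc
    have hlen : pathLength (ballMetric ρ) γ =
        ∫ t in (0 : ℝ)..1, 2 * ρ ^ 2 / (ρ ^ 2 - ‖γ t‖ ^ 2) * ‖D t‖ := by
      refine intervalIntegral.integral_congr fun t ht => ?_
      rw [uIcc_of_le zero_le_one] at ht
      exact sqrt_ballMetric_apply (hmaps ht) _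
    have hi1 : IntervalIntegrable
        (fun t => 2 * ρ ^ 2 / (ρ ^ 2 - (inner ℝ e (γ t)) ^ 2) * inner ℝ e (D t))
        volume 0 1 := by
      refine ContinuousOn.intervalIntegrable ?_
      rw [uIcc_of_le zero_le_one]
      exact (continuousOn_const.div (continuousOn_const.sub (hic.pow 2))
        fun t ht => (hpos _ (hlt t ht)).ne').mul (continuousOn_const.inner hDc)
    have hftc : ∫ t in (0 : ℝ)..1,
        2 * ρ ^ 2 / (ρ ^ 2 - (inner ℝ e (γ t)) ^ 2) * inner ℝ e (D t) =
          2 * ρ * Real.artanh (‖m‖ / ρ) := by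
      rw [intervalIntegral.integral_eq_sub_of_hasDerivAt_of_le zero_le_one
        (f := fun t => 2 * ρ * Real.artanh (inner ℝ e (γ t) / ρ)) ?_ ?_ hi1]
      · simp [h0, h1, hme]
      · intro t ht
        have := (hasDerivAt_two_mul_artanh_div (hlt t ht)).continuousAt
        exact ContinuousAt.comp_continuousWithinAt (f := fun t => (inner ℝ e (γ t) : ℝ)) this
          (hic t ht)
      · intro t ht
        have ht' := Ioo_subset_Icc_self ht
        have hd : HasDerivAt γ (D t) t :=
          ((hγ.differentiableOn one_ne_zero t ht').hasDerivWithinAt).hasDerivAt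
            (Icc_mem_nhds ht.1 ht.2)
        have hi : HasDerivAt (fun t => (inner ℝ e (γ t) : ℝ)) (inner ℝ e (D t)) t := by
          simpa using (hasDerivAt_const t e).inner ℝ hd
        exact HasDerivAt.comp (h₂ := fun s => 2 * ρ * Real.artanh (s / ρ)) t
          (hasDerivAt_two_mul_artanh_div (hlt t ht')) hi
    rw [hlen, ← hftc]
    refine intervalIntegral.integral_mono_on zero_le_one hi1 ?_ fun t ht => ?_
    · refine ContinuousOn.intervalIntegrable ?_
      rw [uIcc_of_le zero_le_one]
      exact (continuousOn_const.div (continuousOn_const.sub (hγc.norm.pow 2)) fun t ht =>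
        (hpos _ (by simpa using hγb t ht)).ne').mul hDc.norm
    · have h2 : 0 < ρ ^ 2 - ‖γ t‖ ^ 2 := hpos _ (by simpa using hγb t ht)
      have h3 : (inner ℝ e (γ t) : ℝ) ^ 2 ≤ ‖γ t‖ ^ 2 := sq_le_sq.2 (by simpa using hle (γ t))
      calc 2 * ρ ^ 2 / (ρ ^ 2 - (inner ℝ e (γ t)) ^ 2) * inner ℝ e (D t)
          ≤ 2 * ρ ^ 2 / (ρ ^ 2 - (inner ℝ e (γ t)) ^ 2) * ‖D t‖ :=
            mul_le_mul_of_nonneg_left ((le_abs_self _).trans (hle _))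
              (div_nonneg (by positivity) (by linarith))
        _ ≤ _ := by gcongr

theorem norm_eq_mul_tanh_hypDist {n : ℕ} {ρ : ℝ} {m : EuclideanSpace ℝ (Fin n)}
    (hm : m ∈ ball 0 ρ) : ‖m‖ = ρ * Real.tanh (hypDist ρ 0 m / (2 * ρ)) := by
  have hm' : ‖m‖ < ρ := by simpa using hm
  have hρ : 0 < ρ := (norm_nonneg m).trans_lt hm'
  have h1 : 2 * ρ * Real.artanh (‖m‖ / ρ) / (2 * ρ) = Real.artanh (‖m‖ / ρ) := by field_simp
  rw [hypDist_zero_left hm, h1, Real.tanh_artanh ⟨?_, by rwa [div_lt_one hρ]⟩]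
  · field_simp
  · exact neg_one_lt_zero.trans_le (by positivity)

/-! ### Smoothness of integrals depending on a parameter. -/

theorem hasFDerivAt_comp_prodMk {F E G : Type*} [NormedAddCommGroup F] [NormedSpace ℝ F]
    [NormedAddCommGroup E] [NormedSpace ℝ E] [NormedAddCommGroup G] [NormedSpace ℝ G]
    {W : Set (F × E)} {H : F × E → G} (hWo : IsOpen W) (hH : ContDiffOn ℝ 1 H W)
    {v : F} {y : E} (hvy : (v, y) ∈ W) :
    HasFDerivAt (fun z => H (v, z))
      ((fderiv ℝ H (v, y)).comp (ContinuousLinearMap.inr ℝ F E)) y :=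
  HasFDerivAt.comp y (((hH.differentiableOn one_ne_zero).differentiableAt
    (hWo.mem_nhds hvy)).hasFDerivAt) (hasFDerivAt_prodMk_right v y)

section ParametricIntegral

-- `E` and `G` share a universe so that `E →L[ℝ] G` can take the place of `G` in the induction on
-- the order of smoothness.
universe w

variable {X F : Type*} {E G : Type w} [TopologicalSpace X] [NormedAddCommGroup F]
  [NormedAddCommGroup E] [NormedAddCommGroup G] {W : Set (F × E)} {U : Set E} {i : X → F}

theorem continuous_comp_prodMk {K : F × E → G} (hK : ContinuousOn K W)
    (hi : Continuous i) (hW : ∀ x, ∀ y ∈ U, (i x, y) ∈ W) {y : E} (hy : y ∈ U) :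
    Continuous fun x => K (i x, y) :=
  hK.comp_continuous (by fun_prop) fun x => hW x y hy

theorem integrable_comp_prodMk [CompactSpace X] [MeasurableSpace X] [OpensMeasurableSpace X]
    {ν : Measure X} [IsFiniteMeasure ν] {K : F × E → G} (hK : ContinuousOn K W)
    (hi : Continuous i) (hW : ∀ x, ∀ y ∈ U, (i x, y) ∈ W) {y : E} (hy : y ∈ U) :
    Integrable (fun x => K (i x, y)) ν :=
  (continuous_comp_prodMk hK hi hW hy).integrable_of_hasCompactSupport
    (HasCompactSupport.of_compactSpace _)

variable [NormedSpace ℝ E]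

/-- Compactness of `X` times a closed ball yields the constant that dominates the integrands below.
-/
theorem exists_bound_of_continuousOn [CompactSpace X] [FiniteDimensional ℝ E] {K : F × E → G}
    (hK : ContinuousOn K W) (hi : Continuous i) (hU : IsOpen U)
    (hW : ∀ x, ∀ y ∈ U, (i x, y) ∈ W) {y : E} (hy : y ∈ U) :
    ∃ s ∈ 𝓝 y, s ⊆ U ∧ ∃ C, ∀ x, ∀ z ∈ s, ‖K (i x, z)‖ ≤ C := by
  obtain ⟨ε, hε, hs⟩ := nhds_basis_closedBall.mem_iff.1 (hU.mem_nhds hy)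
  have hc : ContinuousOn (fun p : X × E => K (i p.1, p.2)) (univ ×ˢ closedBall y ε) :=
    hK.comp (by fun_prop) fun p hp => hW _ _ (hs hp.2)
  obtain ⟨C, hC⟩ := (isCompact_univ.prod (isCompact_closedBall y ε)).exists_bound_of_continuousOn hc
  exact ⟨_, closedBall_mem_nhds y hε, hs, C, fun x z hz => hC (x, z) ⟨mem_univ _, hz⟩⟩

variable [NormedSpace ℝ G] [CompactSpace X] [SecondCountableTopology X] [MeasurableSpace X]
  [OpensMeasurableSpace X] [FiniteDimensional ℝ E] {ν : Measure X} [IsFiniteMeasure ν]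

theorem continuousOn_integral_param {K : F × E → G} (hK : ContinuousOn K W)
    (hi : Continuous i) (hU : IsOpen U) (hW : ∀ x, ∀ y ∈ U, (i x, y) ∈ W) :
    ContinuousOn (fun y => ∫ x, K (i x, y) ∂ν) U := by
  intro y hy
  obtain ⟨s, hs, hsU, C, hC⟩ := exists_bound_of_continuousOn hK hi hU hW hy
  refine (continuousAt_of_dominated (bound := fun _ => C) ?_ ?_ (integrable_const C)
    ?_).continuousWithinAt
  · filter_upwards [hs] with z hz
    exact (continuous_comp_prodMk hK hi hW (hsU hz)).aestronglyMeasurable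
  · filter_upwards [hs] with z hz using Eventually.of_forall fun x => hC x z hz
  · refine Eventually.of_forall fun x => ?_
    have h1 : ContinuousOn (fun z => K (i x, z)) U := hK.comp (by fun_prop) fun z hz => hW x z hz
    exact h1.continuousAt (hU.mem_nhds hy)

variable [NormedSpace ℝ F]

theorem hasFDerivAt_integral_param {H : F × E → G} (hWo : IsOpen W) (hH : ContDiffOn ℝ 1 H W)
    (hi : Continuous i) (hU : IsOpen U) (hW : ∀ x, ∀ y ∈ U, (i x, y) ∈ W) {y : E} (hy : y ∈ U) :
    HasFDerivAt (fun y => ∫ x, H (i x, y) ∂ν)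
      (∫ x, (fderiv ℝ H (i x, y)).comp (ContinuousLinearMap.inr ℝ F E) ∂ν) y := by
  have hK : ContinuousOn (fun p => (fderiv ℝ H p).comp (ContinuousLinearMap.inr ℝ F E)) W :=
    (hH.continuousOn_fderiv_of_isOpen hWo le_rfl).clm_comp continuousOn_const
  obtain ⟨s, hs, hsU, C, hC⟩ := exists_bound_of_continuousOn hK hi hU hW hy
  refine hasFDerivAt_integral_of_dominated_of_fderiv_le
    (F := fun y x => H (i x, y))
    (F' := fun y x => (fderiv ℝ H (i x, y)).comp (ContinuousLinearMap.inr ℝ F E))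
    (bound := fun _ => C) hs ?_ ?_ ?_ ?_ (integrable_const C) ?_
  · filter_upwards [hs] with z hz
    exact (continuous_comp_prodMk hH.continuousOn hi hW (hsU hz)).aestronglyMeasurable
  · exact integrable_comp_prodMk hH.continuousOn hi hW hy
  · exact (integrable_comp_prodMk hK hi hW hy).aestronglyMeasurable
  · exact Eventually.of_forall hC
  · exact Eventually.of_forall fun x z hz => hasFDerivAt_comp_prodMk hWo hH (hW x z (hsU hz))

/-- The derivative of such an integral is an integral of the same kind, with values in `E →L[ℝ] G`
and an integrand one order less smooth; hence the induction with `G` varying. -/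
theorem contDiffOn_integral_param {n : ℕ} {H : F × E → G} (hWo : IsOpen W)
    (hH : ContDiffOn ℝ n H W) (hi : Continuous i) (hU : IsOpen U)
    (hW : ∀ x, ∀ y ∈ U, (i x, y) ∈ W) :
    ContDiffOn ℝ n (fun y => ∫ x, H (i x, y) ∂ν) U := by
  induction n generalizing G with
  | zero => exact contDiffOn_zero.2 (continuousOn_integral_param (contDiffOn_zero.1 hH) hi hU hW)
  | succ n ih =>
    have hH1 : ContDiffOn ℝ 1 H W := hH.of_le (by exact_mod_cast Nat.le_add_left 1 n)
    have hd := fun y hy => hasFDerivAt_integral_param (ν := ν) hWo hH1 hi hU hW (y := y) hy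
    push_cast
    rw [contDiffOn_succ_iff_fderiv_of_isOpen hU]
    refine ⟨fun y hy => (hd y hy).differentiableAt.differentiableWithinAt, by simp, ?_⟩
    have hK : ContDiffOn ℝ n (fun p => (fderiv ℝ H p).comp (ContinuousLinearMap.inr ℝ F E)) W :=
      (hH.fderiv_of_isOpen hWo (by simp)).clm_comp contDiffOn_const
    exact (ih hK).congr fun y hy => (hd y hy).fderiv

end ParametricIntegral

/-! ### Rotation invariance and spherical means. -/

section Sphere

variable {n : ℕ}

local notation "𝔼" => EuclideanSpace ℝ (Fin n)

/-- The surface measure of `s` is the dimension times the volume of the cone over `s`. An isometry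
maps the cone over `s` to the cone over its image and preserves volume. -/
theorem measurePreserving_sphere_map (R : 𝔼 ≃ₗᵢ[ℝ] 𝔼) :
    MeasurePreserving
      (fun θ : sphere (0 : 𝔼) 1 => (⟨R θ, by simp⟩ : sphere (0 : 𝔼) 1))
      (volume : Measure 𝔼).toSphere (volume : Measure 𝔼).toSphere := by
  have hc : Continuous (fun θ : sphere (0 : 𝔼) 1 => (⟨R θ, by simp⟩ : sphere (0 : 𝔼) 1)) :=
    (R.continuous.comp continuous_subtype_val).subtype_mk _
  refine ⟨hc.measurable, Measure.ext fun s hs => ?_⟩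
  rw [Measure.map_apply hc.measurable hs, Measure.toSphere_apply' _ hs,
    Measure.toSphere_apply' _ (hc.measurable hs)]
  congr 1
  refine Eq.trans (congrArg _ ?_)
    (R.measurePreserving.measure_preimage_equiv (f := R.toMeasurableEquiv) _)
  ext x
  simp only [Set.mem_smul, mem_image, mem_preimage]
  constructor
  · rintro ⟨t, ht, _, ⟨θ, hθ, rfl⟩, rfl⟩
    exact ⟨t, ht, _, ⟨_, hθ, rfl⟩, by simp⟩
  · rintro ⟨t, ht, _, ⟨θ, hθ, rfl⟩, h⟩
    refine ⟨t, ht, _, ⟨⟨R.symm θ, by simp⟩, by simpa using hθ, rfl⟩, ?_⟩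
    apply R.injective
    simpa using h

theorem integral_sphere_comp (R : 𝔼 ≃ₗᵢ[ℝ] 𝔼) (g : 𝔼 → ℂ) :
    ∫ θ : sphere (0 : 𝔼) 1, g (R θ) ∂(volume : Measure 𝔼).toSphere =
      ∫ θ : sphere (0 : 𝔼) 1, g θ ∂(volume : Measure 𝔼).toSphere := by
  have hc : Continuous (fun θ : sphere (0 : 𝔼) 1 => (⟨R θ, by simp⟩ : sphere (0 : 𝔼) 1)) :=
    (R.continuous.comp continuous_subtype_val).subtype_mk _
  have he := hc.measurableEmbedding fun a b h =>
    Subtype.ext (R.injective (congrArg Subtype.val h))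
  exact (measurePreserving_sphere_map R).integral_comp he (fun θ => g θ)

end Sphere

theorem sphericalMean_of_pos {k : ℕ} (f : EuclideanSpace ℝ (Fin (k + 1)) → ℂ) {η : ℝ}
    (hη : 0 < η) :
    sphericalMean k f η =
      ((volume : Measure (EuclideanSpace ℝ (Fin (k + 1)))).toSphere.real univ)⁻¹ •
        ∫ θ : sphere (0 : EuclideanSpace ℝ (Fin (k + 1))) 1,
          f (η • (θ : EuclideanSpace ℝ (Fin (k + 1))))
          ∂(volume : Measure (EuclideanSpace ℝ (Fin (k + 1)))).toSphere := by
  have hc : Continuous (fun θ : sphere (0 : EuclideanSpace ℝ (Fin (k + 1))) 1 =>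
      η • (θ : EuclideanSpace ℝ (Fin (k + 1)))) := by fun_prop
  have he := hc.measurableEmbedding fun a b h =>
    Subtype.ext (smul_right_injective _ hη.ne' h)
  rw [sphericalMean, if_neg hη.ne', sphereMeasure, integral_smul_measure, he.integral_map,
    measureReal_ennreal_smul_apply, measureReal_def, Measure.map_apply hc.measurable .univ,
    preimage_univ, ENNReal.toReal_ofReal (by positivity), smul_smul, mul_inv,
    ← measureReal_def]
  congr 1
  field_simp

/-- This trades averaging over the position of `m` for averaging over the boundary point. On the
right `m` is a mere parameter of a smooth integrand over a fixed sphere, with no exception at the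
origin. -/
theorem V_norm {k : ℕ} {ρ : ℝ} {u m : EuclideanSpace ℝ (Fin (k + 1))} (hu : ‖u‖ = ρ) (hρ : 0 < ρ)
    (α : ℂ) :
    V k u α ‖m‖ =
      ((volume : Measure (EuclideanSpace ℝ (Fin (k + 1)))).toSphere.real univ)⁻¹ •
        ∫ θ : sphere (0 : EuclideanSpace ℝ (Fin (k + 1))) 1,
          (omega (ρ • (θ : EuclideanSpace ℝ (Fin (k + 1)))) m : ℂ) ^ α
          ∂(volume : Measure (EuclideanSpace ℝ (Fin (k + 1)))).toSphere := by
  have hn : ∀ θ : sphere (0 : EuclideanSpace ℝ (Fin (k + 1))) 1,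
      ‖(θ : EuclideanSpace ℝ (Fin (k + 1)))‖ = 1 := fun θ => by simp
  rcases eq_or_ne m 0 with rfl | hm
  · have h1 : ∀ v : EuclideanSpace ℝ (Fin (k + 1)), ‖v‖ = ρ → omega v 0 = 1 := fun v hv => by
      simp [omega, hv, hρ.ne']
    have h2 : (volume : Measure (EuclideanSpace ℝ (Fin (k + 1)))).toSphere.real univ ≠ 0 := by
      rw [Measure.toSphere_real_apply_univ]
      have : (0 : ℝ) < volume.real (ball (0 : EuclideanSpace ℝ (Fin (k + 1))) 1) :=
        ENNReal.toReal_pos (measure_ball_pos _ _ one_pos).ne' measure_ball_lt_top.ne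
      simp [this.ne', Nat.cast_add_one_ne_zero]
    rw [norm_zero, V, sphericalMean, if_pos rfl, h1 u hu]
    have h3 : ∀ θ : sphere (0 : EuclideanSpace ℝ (Fin (k + 1))) 1,
        omega (ρ • (θ : EuclideanSpace ℝ (Fin (k + 1)))) 0 = 1 := fun θ =>
      h1 _ (by rw [norm_smul, hn, mul_one, Real.norm_of_nonneg hρ.le])
    simp only [h3, Complex.ofReal_one, Complex.one_cpow]
    rw [integral_const, smul_smul, inv_mul_cancel₀ h2, one_smul]
  · have hη : 0 < ‖m‖ := norm_pos_iff.2 hm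
    rw [V, sphericalMean_of_pos _ hη]
    congr 1
    set e := ρ⁻¹ • u with he
    have hue : u = ρ • e := by rw [he, smul_smul, mul_inv_cancel₀ hρ.ne', one_smul]
    have hen : ‖e‖ = 1 := by
      rw [he, norm_smul, hu, norm_inv, Real.norm_of_nonneg hρ.le, inv_mul_cancel₀ hρ.ne']
    -- The reflection exchanging the unit vectors `e = u/ρ` and `m/|m|`.
    set R := (ℝ ∙ (e - ‖m‖⁻¹ • m))ᗮ.reflection
    have hR : R e = ‖m‖⁻¹ • m := Submodule.reflection_sub (by
      rw [hen, norm_smul, norm_inv, norm_norm, inv_mul_cancel₀ hη.ne'])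
    have hmR : m = R (‖m‖ • e) := by
      rw [map_smul, hR, smul_smul, mul_inv_cancel₀ hη.ne', one_smul]
    rw [← integral_sphere_comp R
      fun v => (omega (ρ • v) m : ℂ) ^ α]
    refine integral_congr_ae (Eventually.of_forall fun θ => ?_)
    -- Removing `R` leaves `|ρθ - |m|e|`, which equals `|ρe - |m|θ|` because `e` and `θ` are both
    -- unit vectors.
    have h1 : ‖ρ • R (θ : EuclideanSpace ℝ (Fin (k + 1))) - m‖ ^ 2 =
        ‖u - ‖m‖ • (θ : EuclideanSpace ℝ (Fin (k + 1)))‖ ^ 2 := by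
      conv_lhs => rw [hmR, ← map_smul, ← map_sub, R.norm_map]
      rw [hue, norm_sub_sq_real, norm_sub_sq_real]
      simp only [norm_smul, hn, hen, real_inner_smul_left, real_inner_smul_right]
      rw [real_inner_comm]
    have h2 : ‖ρ • R (θ : EuclideanSpace ℝ (Fin (k + 1)))‖ = ρ := by
      rw [norm_smul, R.norm_map, hn, mul_one, Real.norm_of_nonneg hρ.le]
    have h3 : ‖‖m‖ • (θ : EuclideanSpace ℝ (Fin (k + 1)))‖ = ‖m‖ := by
      rw [norm_smul, hn, mul_one, norm_norm]
    simp only [omega, h1, h2, h3, hu]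

/-! ### The hyperbolic Laplacian in coordinates and under an integral. -/

section Laplacian

variable {k : ℕ} {ρ : ℝ}

local notation "𝔼" => EuclideanSpace ℝ (Fin (k + 1))

theorem partialDeriv_congr {n : ℕ} {i : Fin n} {f g : EuclideanSpace ℝ (Fin n) → ℂ}
    {x : EuclideanSpace ℝ (Fin n)} (h : f =ᶠ[𝓝 x] g) : partialDeriv i f x = partialDeriv i g x := by
  rw [partialDeriv, partialDeriv, h.fderiv_eq]

/-- The factor `2 ρ² / (ρ² - |x|²)` by which the metric of the ball model is conformal to the
Euclidean one. -/
noncomputable def conformalFactor {n : ℕ} (ρ : ℝ) (x : EuclideanSpace ℝ (Fin n)) : ℝ :=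
  2 * ρ ^ 2 / (ρ ^ 2 - ‖x‖ ^ 2)

theorem sq_sub_norm_sq_pos {n : ℕ} {x : EuclideanSpace ℝ (Fin n)} (hx : x ∈ ball 0 ρ) :
    0 < ρ ^ 2 - ‖x‖ ^ 2 := by
  have hx' : ‖x‖ < ρ := by simpa using hx
  nlinarith [norm_nonneg x]

theorem conformalFactor_pos {n : ℕ} {x : EuclideanSpace ℝ (Fin n)} (hx : x ∈ ball 0 ρ) :
    0 < conformalFactor ρ x := by
  have hρ : 0 < ρ := (norm_nonneg x).trans_lt (by simpa using hx)
  exact div_pos (by positivity) (sq_sub_norm_sq_pos hx)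

/-- For a metric `λ²` times the Euclidean one in dimension `k + 1`, the root of the determinant is
`λ^(k+1)` and the inverse contributes `λ⁻²`. The hypothesis `1 ≤ k` makes the natural-number
exponent `k - 1` the true one. -/
theorem hypLaplacian_eq (hk : 1 ≤ k) (f : 𝔼 → ℂ) {x : 𝔼} (hx : x ∈ ball 0 ρ) :
    hypLaplacian ρ f x = (conformalFactor ρ x ^ (k + 1))⁻¹ •
      ∑ i, partialDeriv i (fun y => conformalFactor ρ y ^ (k - 1) • partialDeriv i f y) x := by
  have hdet : ∀ y ∈ ball (0 : 𝔼) ρ, √(ballMetric ρ y).det = conformalFactor ρ y ^ (k + 1) := by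
    intro y hy
    rw [ballMetric, Matrix.det_smul, Matrix.det_one, mul_one, Fintype.card_fin, ← pow_mul,
      mul_comm 2 (k + 1), pow_mul, ← conformalFactor,
      Real.sqrt_sq (pow_nonneg (conformalFactor_pos hy).le _)]
  have hinv : ∀ y ∈ ball (0 : 𝔼) ρ,
      (ballMetric ρ y)⁻¹ =
        (conformalFactor ρ y ^ 2)⁻¹ • (1 : Matrix (Fin (k + 1)) (Fin (k + 1)) ℝ) := by
    intro y hy
    refine Matrix.inv_eq_right_inv ?_
    rw [ballMetric, smul_mul_smul_comm, mul_one]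
    have := (conformalFactor_pos hy).ne'
    rw [show 2 * ρ ^ 2 / (ρ ^ 2 - ‖y‖ ^ 2) = conformalFactor ρ y from rfl,
      mul_inv_cancel₀ (by positivity), one_smul]
  rw [hypLaplacian, laplaceBeltrami, hdet x hx]
  congr 1
  refine Finset.sum_congr rfl fun i _ => partialDeriv_congr ?_
  filter_upwards [isOpen_ball.mem_nhds hx] with y hy
  have h0 := (conformalFactor_pos hy).ne'
  rw [hdet y hy, hinv y hy, Finset.sum_eq_single i]
  · rw [smul_smul, Matrix.smul_apply, Matrix.one_apply_eq, smul_eq_mul, mul_one]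
    congr 1
    obtain ⟨l, rfl⟩ : ∃ l, k = l + 1 := ⟨k - 1, by omega⟩
    rw [Nat.add_sub_cancel]
    field_simp
    ring
  · intro j _ hj
    rw [Matrix.smul_apply, Matrix.one_apply_ne hj.symm, smul_zero, zero_smul]
  · simp

theorem hypLaplacian_congr (hk : 1 ≤ k) {f g : 𝔼 → ℂ} {x : 𝔼} (hx : x ∈ ball 0 ρ)
    (h : f =ᶠ[𝓝 x] g) : hypLaplacian ρ f x = hypLaplacian ρ g x := by
  rw [hypLaplacian_eq hk f hx, hypLaplacian_eq hk g hx]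
  congr 1
  refine Finset.sum_congr rfl fun i _ => partialDeriv_congr ?_
  filter_upwards [h.eventuallyEq_nhds] with y hy
  rw [partialDeriv_congr hy]

theorem hypLaplacian_const_smul (hk : 1 ≤ k) (a : ℝ) (f : 𝔼 → ℂ) {x : 𝔼}
    (hx : x ∈ ball 0 ρ) :
    hypLaplacian ρ (fun y => a • f y) x = a • hypLaplacian ρ f x := by
  have h : ∀ (i : Fin (k + 1)) (f : 𝔼 → ℂ) y,
      partialDeriv i (fun y => a • f y) y = a • partialDeriv i f y := fun i f y => by
    rw [partialDeriv, partialDeriv, show (fun y => a • f y) = a • f from rfl,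
      fderiv_const_smul_field]
    rfl
  rw [hypLaplacian_eq hk _ hx, hypLaplacian_eq hk _ hx, smul_comm a]
  congr 1
  rw [Finset.smul_sum]
  refine Finset.sum_congr rfl fun i _ => ?_
  simp only [h, smul_comm _ a]

theorem contDiffOn_conformalFactor {n : ℕ} {N : WithTop ℕ∞} :
    ContDiffOn ℝ N (conformalFactor (n := n) ρ) (ball 0 ρ) :=
  contDiffOn_const.div (contDiffOn_const.sub (contDiff_id.norm_sq ℝ).contDiffOn)
    fun _ hx => (sq_sub_norm_sq_pos hx).ne'

theorem hypLaplacian_integral {X F : Type*} [TopologicalSpace X] [CompactSpace X]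
    [SecondCountableTopology X] [MeasurableSpace X] [OpensMeasurableSpace X]
    [NormedAddCommGroup F] [NormedSpace ℝ F] {ν : Measure X} [IsFiniteMeasure ν]
    (hk : 1 ≤ k) {W : Set (F × 𝔼)} (hWo : IsOpen W) {H : F × 𝔼 → ℂ} (hH : ContDiffOn ℝ 2 H W)
    {i : X → F} (hi : Continuous i) (hW : ∀ x, ∀ y ∈ ball (0 : 𝔼) ρ, (i x, y) ∈ W)
    {y : 𝔼} (hy : y ∈ ball 0 ρ) :
    hypLaplacian ρ (fun y => ∫ x, H (i x, y) ∂ν) y =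
      ∫ x, hypLaplacian ρ (fun y => H (i x, y)) y ∂ν := by
  have hdiff : ∀ {W : Set (F × 𝔼)} (_ : IsOpen W) {K : F × 𝔼 → ℂ} (_ : ContDiffOn ℝ 1 K W)
      (_ : ∀ x, ∀ y ∈ ball (0 : 𝔼) ρ, (i x, y) ∈ W) (j : Fin (k + 1)) {z : 𝔼}
      (_ : z ∈ ball 0 ρ),
      partialDeriv j (fun y => ∫ x, K (i x, y) ∂ν) z =
        ∫ x, fderiv ℝ K (i x, z) (0, EuclideanSpace.single j 1) ∂ν := by
    intro W hWo K hK hW j z hz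
    have hc : ContinuousOn (fun p => (fderiv ℝ K p).comp (ContinuousLinearMap.inr ℝ F 𝔼)) W :=
      (hK.continuousOn_fderiv_of_isOpen hWo le_rfl).clm_comp continuousOn_const
    rw [partialDeriv, (hasFDerivAt_integral_param hWo hK hi isOpen_ball hW hz).fderiv,
      ContinuousLinearMap.integral_apply (integrable_comp_prodMk hc hi hW hz)]
    rfl
  have hpart : ∀ {W : Set (F × 𝔼)} (_ : IsOpen W) {K : F × 𝔼 → ℂ} (_ : ContDiffOn ℝ 1 K W)
      {p : F × 𝔼} (_ : p ∈ W) (j : Fin (k + 1)),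
      partialDeriv j (fun y => K (p.1, y)) p.2 =
        fderiv ℝ K p (0, EuclideanSpace.single j 1) := by
    intro W hWo K hK p hp j
    rw [partialDeriv, (hasFDerivAt_comp_prodMk hWo hK hp).fderiv]
    rfl
  -- The second differentiation also meets the conformal factor, which is known to be smooth only
  -- over the ball.
  set W' := W ∩ Prod.snd ⁻¹' ball (0 : 𝔼) ρ with hW'
  have hWo' : IsOpen W' := hWo.inter (isOpen_ball.preimage continuous_snd)
  have hmem : ∀ x, ∀ y ∈ ball (0 : 𝔼) ρ, (i x, y) ∈ W' := fun x y hy => ⟨hW x y hy, hy⟩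
  set M : Fin (k + 1) → F × 𝔼 → ℂ := fun j p =>
    conformalFactor ρ p.2 ^ (k - 1) • fderiv ℝ H p (0, EuclideanSpace.single j 1) with hM
  have hH1 : ContDiffOn ℝ 1 H W := hH.of_le one_le_two
  have hMc : ∀ j, ContDiffOn ℝ 1 (M j) W' := fun j =>
    ((contDiffOn_conformalFactor.comp contDiffOn_snd fun p hp => hp.2).pow (k - 1)).smul
      (((hH.fderiv_of_isOpen hWo (by norm_num)).mono inter_subset_left).clm_apply contDiffOn_const)
  have hr : ∀ x, hypLaplacian ρ (fun y => H (i x, y)) y = (conformalFactor ρ y ^ (k + 1))⁻¹ •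
      ∑ j, fderiv ℝ (M j) (i x, y) (0, EuclideanSpace.single j 1) := fun x => by
    rw [hypLaplacian_eq hk _ hy]
    congr 1
    refine Finset.sum_congr rfl fun j _ => ?_
    rw [← hpart hWo' (hMc j) (hmem x y hy) j]
    refine partialDeriv_congr ?_
    filter_upwards [isOpen_ball.mem_nhds hy] with z hz
    simp only [hM]
    rw [← hpart hWo hH1 (hW x z hz) j]
  simp only [hr]
  rw [integral_smul, integral_finsetSum, hypLaplacian_eq hk _ hy]
  · congr 1
    refine Finset.sum_congr rfl fun j _ => ?_
    rw [← hdiff hWo' (hMc j) hmem j hy]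
    refine partialDeriv_congr ?_
    filter_upwards [isOpen_ball.mem_nhds hy] with z hz
    rw [hdiff hWo hH1 hW j hz, ← integral_smul]
  · intro j _
    have hc : ContinuousOn (fun p => fderiv ℝ (M j) p (0, EuclideanSpace.single j 1)) W' :=
      ((hMc j).continuousOn_fderiv_of_isOpen hWo' le_rfl).clm_apply continuousOn_const
    exact integrable_comp_prodMk hc hi hmem hy

end Laplacian

/-! ### Powers of `ω` are eigenfunctions. -/

section PoissonKernelPower

theorem partialDeriv_eq_of_hasDerivAt {n : ℕ} {i : Fin n} {f : EuclideanSpace ℝ (Fin n) → ℂ}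
    {x : EuclideanSpace ℝ (Fin n)} (hf : DifferentiableAt ℝ f x) {d : ℂ}
    (hd : HasDerivAt (fun t : ℝ => f (x + t • EuclideanSpace.single i 1)) d 0) :
    partialDeriv i f x = d := by
  rw [partialDeriv, ← hf.lineDeriv_eq_fderiv]
  exact hd.deriv

theorem norm_add_smul_single_sq {n : ℕ} (x : EuclideanSpace ℝ (Fin n)) (t : ℝ) (i : Fin n) :
    ‖x + t • EuclideanSpace.single i (1 : ℝ)‖ ^ 2 = ‖x‖ ^ 2 + 2 * x i * t + t ^ 2 := by
  rw [norm_add_sq_real, real_inner_smul_right, EuclideanSpace.inner_single_right, norm_smul,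
    PiLp.norm_single]
  simp
  ring

theorem norm_sub_add_smul_single_sq {n : ℕ} (v x : EuclideanSpace ℝ (Fin n)) (t : ℝ) (i : Fin n) :
    ‖v - (x + t • EuclideanSpace.single i (1 : ℝ))‖ ^ 2 =
      ‖v - x‖ ^ 2 - 2 * (v i - x i) * t + t ^ 2 := by
  have h : v - (x + t • EuclideanSpace.single i (1 : ℝ)) =
      (v - x) + (-t) • EuclideanSpace.single i (1 : ℝ) := by
    rw [neg_smul]; abel
  rw [h, norm_add_smul_single_sq, PiLp.sub_apply]
  ring

theorem hasDerivAt_sq_sub_norm_sq_line {n : ℕ} (a : ℝ) (x : EuclideanSpace ℝ (Fin n)) (i : Fin n) :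
    HasDerivAt (fun t : ℝ => a ^ 2 - ‖x + t • EuclideanSpace.single i (1 : ℝ)‖ ^ 2)
      (-2 * x i) 0 := by
  simp only [norm_add_smul_single_sq]
  have := ((((hasDerivAt_id (0 : ℝ)).const_mul (2 * x i)).const_add (‖x‖ ^ 2)).add
    ((hasDerivAt_id (0 : ℝ)).pow 2)).const_sub (a ^ 2)
  simpa using this

theorem hasDerivAt_norm_sub_sq_line {n : ℕ} (v x : EuclideanSpace ℝ (Fin n)) (i : Fin n) :
    HasDerivAt (fun t : ℝ => ‖v - (x + t • EuclideanSpace.single i (1 : ℝ))‖ ^ 2)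
      (-2 * (v i - x i)) 0 := by
  simp only [norm_sub_add_smul_single_sq]
  refine ((((hasDerivAt_id (0 : ℝ)).const_mul (2 * (v i - x i))).const_sub (‖v - x‖ ^ 2)).add
    ((hasDerivAt_id (0 : ℝ)).pow 2)).congr_deriv ?_
  simp

variable {k : ℕ} {ρ : ℝ}

local notation "𝔼" => EuclideanSpace ℝ (Fin (k + 1))

theorem norm_sub_pos_of_norm_lt {n : ℕ} {v m : EuclideanSpace ℝ (Fin n)} (h : ‖m‖ < ‖v‖) :
    0 < ‖v - m‖ :=
  norm_pos_iff.2 (sub_ne_zero.2 fun hvm => by simp [hvm] at h)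

/-- As `ω > 0` here, the complex power is an exponential of real logarithms; smoothness and
derivatives are read off this form. -/
theorem omega_cpow_eq_exp {n : ℕ} {v m : EuclideanSpace ℝ (Fin n)} (h : ‖m‖ < ‖v‖) (α : ℂ) :
    (omega v m : ℂ) ^ α =
      Complex.exp (α * ((Real.log (‖v‖ ^ 2 - ‖m‖ ^ 2) - Real.log (‖v - m‖ ^ 2) : ℝ) : ℂ)) := by
  have h1 : 0 < ‖v‖ ^ 2 - ‖m‖ ^ 2 := sq_sub_norm_sq_pos (by simpa using h)
  have h2 : 0 < ‖v - m‖ ^ 2 := pow_pos (norm_sub_pos_of_norm_lt h) 2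
  have h3 : 0 < omega v m := div_pos h1 h2
  rw [Complex.cpow_def_of_ne_zero (by exact_mod_cast h3.ne'), ← Complex.ofReal_log h3.le, omega,
    Real.log_div h1.ne' h2.ne', mul_comm]

theorem isOpen_setOf_norm_snd_lt {n : ℕ} :
    IsOpen {p : EuclideanSpace ℝ (Fin n) × EuclideanSpace ℝ (Fin n) | ‖p.2‖ < ‖p.1‖} :=
  isOpen_lt (by fun_prop) (by fun_prop)

theorem contDiffOn_omega_cpow {n : ℕ} {N : WithTop ℕ∞} (α : ℂ) :
    ContDiffOn ℝ N
      (fun p : EuclideanSpace ℝ (Fin n) × EuclideanSpace ℝ (Fin n) => (omega p.1 p.2 : ℂ) ^ α)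
      {p | ‖p.2‖ < ‖p.1‖} := by
  refine ContDiffOn.congr ?_ fun p hp => omega_cpow_eq_exp hp α
  refine ContDiffOn.cexp (contDiffOn_const.mul ?_)
  refine Complex.ofRealCLM.contDiff.comp_contDiffOn (ContDiffOn.sub ?_ ?_)
  · exact ((contDiff_fst.norm_sq ℝ).sub (contDiff_snd.norm_sq ℝ)).contDiffOn.log
      fun p hp => (sq_sub_norm_sq_pos (by simpa using hp)).ne'
  · exact ((contDiff_fst.sub contDiff_snd).norm_sq ℝ).contDiffOn.log
      fun p hp => (pow_pos (norm_sub_pos_of_norm_lt hp) 2).ne'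

/-- The partial derivative `∂ᵢ log ω(v, ·)` at a point of the ball of radius `|v|`. -/
noncomputable def logOmegaDeriv {n : ℕ} (v x : EuclideanSpace ℝ (Fin n)) (i : Fin n) : ℝ :=
  -2 * x i / (‖v‖ ^ 2 - ‖x‖ ^ 2) + 2 * (v i - x i) / ‖v - x‖ ^ 2

theorem hasDerivAt_omega_cpow_line {n : ℕ} {v x : EuclideanSpace ℝ (Fin n)} (h : ‖x‖ < ‖v‖)
    (α : ℂ) (i : Fin n) :
    HasDerivAt (fun t : ℝ => (omega v (x + t • EuclideanSpace.single i 1) : ℂ) ^ α)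
      ((omega v x : ℂ) ^ α * (α * (logOmegaDeriv v x i : ℂ))) 0 := by
  have h1 : 0 < ‖v‖ ^ 2 - ‖x‖ ^ 2 := sq_sub_norm_sq_pos (by simpa using h)
  have h2 : 0 < ‖v - x‖ ^ 2 := pow_pos (norm_sub_pos_of_norm_lt h) 2
  have hp := hasDerivAt_sq_sub_norm_sq_line ‖v‖ x i
  have hq := hasDerivAt_norm_sub_sq_line v x i
  have hL := (hp.log (by simpa using h1.ne')).sub (hq.log (by simpa using h2.ne'))
  have hE := (hL.ofReal_comp.const_mul α).cexp
  have hnear : ∀ᶠ t : ℝ in 𝓝 0, ‖x + t • EuclideanSpace.single i (1 : ℝ)‖ < ‖v‖ := by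
    have hc : Continuous fun t : ℝ => ‖x + t • EuclideanSpace.single i (1 : ℝ)‖ := by fun_prop
    exact hc.continuousAt.eventually_lt continuousAt_const (by simpa using h)
  refine (hE.congr_of_eventuallyEq ?_).congr_deriv ?_
  · filter_upwards [hnear] with t ht using omega_cpow_eq_exp ht α
  · simp only [Pi.sub_apply, zero_smul, add_zero]
    rw [omega_cpow_eq_exp h, logOmegaDeriv]
    congr 4
    ring

theorem partialDeriv_omega_cpow {n : ℕ} {v x : EuclideanSpace ℝ (Fin n)} (h : ‖x‖ < ‖v‖)
    (α : ℂ) (i : Fin n) :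
    partialDeriv i (fun y => (omega v y : ℂ) ^ α) x =
      (omega v x : ℂ) ^ α * (α * (logOmegaDeriv v x i : ℂ)) := by
  have h1 := hasFDerivAt_comp_prodMk isOpen_setOf_norm_snd_lt (contDiffOn_omega_cpow α)
    (show (v, x) ∈ _ from h)
  exact partialDeriv_eq_of_hasDerivAt h1.differentiableAt (hasDerivAt_omega_cpow_line h α i)

theorem contDiffOn_logOmegaDeriv {n : ℕ} {N : WithTop ℕ∞} (v : EuclideanSpace ℝ (Fin n))
    (i : Fin n) : ContDiffOn ℝ N (fun x => logOmegaDeriv v x i) (ball 0 ‖v‖) := by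
  have hc : ContDiff ℝ N fun x : EuclideanSpace ℝ (Fin n) => x i := by fun_prop
  refine ContDiffOn.add (ContDiffOn.div ?_ ?_ ?_) (ContDiffOn.div ?_ ?_ ?_)
  · exact (contDiff_const.mul hc).contDiffOn
  · exact (contDiff_const.sub (contDiff_id.norm_sq ℝ)).contDiffOn
  · exact fun x hx => (sq_sub_norm_sq_pos hx).ne'
  · exact (contDiff_const.mul (contDiff_const.sub hc)).contDiffOn
  · exact ((contDiff_const.sub contDiff_id).norm_sq ℝ).contDiffOn
  · exact fun x hx => (pow_pos (norm_sub_pos_of_norm_lt (by simpa using hx)) 2).ne'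

/-- The second partial derivative `∂ᵢ² log ω(v, ·)`. -/
noncomputable def logOmegaDerivDeriv {n : ℕ} (v x : EuclideanSpace ℝ (Fin n)) (i : Fin n) : ℝ :=
  -2 / (‖v‖ ^ 2 - ‖x‖ ^ 2) - 4 * x i ^ 2 / (‖v‖ ^ 2 - ‖x‖ ^ 2) ^ 2 - 2 / ‖v - x‖ ^ 2 +
    4 * (v i - x i) ^ 2 / (‖v - x‖ ^ 2) ^ 2

theorem partialDeriv_conformalFactor_pow_smul {n : ℕ} {v x : EuclideanSpace ℝ (Fin n)}
    (h : ‖x‖ < ‖v‖) (α : ℂ) (i : Fin n) (l : ℕ) :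
    partialDeriv i (fun y => conformalFactor ‖v‖ y ^ l •
        ((omega v y : ℂ) ^ α * (α * (logOmegaDeriv v y i : ℂ)))) x =
      conformalFactor ‖v‖ x ^ l • ((omega v x : ℂ) ^ α * α *
        (((l * (2 * x i / (‖v‖ ^ 2 - ‖x‖ ^ 2)) * logOmegaDeriv v x i +
          logOmegaDerivDeriv v x i : ℝ) : ℂ)
          + α * ((logOmegaDeriv v x i ^ 2 : ℝ) : ℂ))) := by
  have h1 : 0 < ‖v‖ ^ 2 - ‖x‖ ^ 2 := sq_sub_norm_sq_pos (by simpa using h)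
  have h2 : 0 < ‖v - x‖ ^ 2 := pow_pos (norm_sub_pos_of_norm_lt h) 2
  have hp := hasDerivAt_sq_sub_norm_sq_line ‖v‖ x i
  have hq := hasDerivAt_norm_sub_sq_line v x i
  have hx : HasDerivAt (fun t : ℝ => (x + t • EuclideanSpace.single i (1 : ℝ)) i) 1 0 := by
    simpa using (hasDerivAt_id (0 : ℝ)).const_add (x i)
  have hL : HasDerivAt (fun t : ℝ => logOmegaDeriv v (x + t • EuclideanSpace.single i (1 : ℝ)) i)
      (logOmegaDerivDeriv v x i) 0 := by
    refine (((hx.const_mul (-2)).div hp (by simpa using h1.ne')).add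
      (((hx.const_sub (v i)).const_mul 2).div hq (by simpa using h2.ne'))).congr_deriv ?_
    simp only [zero_smul, add_zero, logOmegaDerivDeriv]
    generalize ‖v‖ ^ 2 - ‖x‖ ^ 2 = P at h1 ⊢
    generalize ‖v - x‖ ^ 2 = Q at h2 ⊢
    field_simp
    ring
  have hc : HasDerivAt
      (fun t : ℝ => conformalFactor ‖v‖ (x + t • EuclideanSpace.single i (1 : ℝ)) ^ l)
      (conformalFactor ‖v‖ x ^ l * (l * (2 * x i / (‖v‖ ^ 2 - ‖x‖ ^ 2)))) 0 := by
    refine (((hasDerivAt_const 0 (2 * ‖v‖ ^ 2)).div hp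
      (by simpa using h1.ne')).pow l).congr_deriv ?_
    simp only [zero_smul, add_zero, conformalFactor, Pi.div_apply]
    generalize ‖v‖ ^ 2 - ‖x‖ ^ 2 = P at h1 ⊢
    cases l with
    | zero => simp
    | succ l =>
      rw [Nat.add_sub_cancel, pow_succ _ l]
      generalize (2 * ‖v‖ ^ 2 / P) ^ l = c
      field_simp
      ring
  refine partialDeriv_eq_of_hasDerivAt ?_ ?_
  · have hx : x ∈ ball 0 ‖v‖ := by simpa using h
    have hf := hasFDerivAt_comp_prodMk isOpen_setOf_norm_snd_lt (contDiffOn_omega_cpow α)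
      (show (v, x) ∈ _ from h)
    have hl : DifferentiableAt ℝ (fun y => (logOmegaDeriv v y i : ℂ)) x :=
      Complex.ofRealCLM.differentiableAt.comp x
        (((contDiffOn_logOmegaDeriv (N := 1) v i).differentiableOn one_ne_zero).differentiableAt
          (isOpen_ball.mem_nhds hx))
    have hcf : DifferentiableAt ℝ (conformalFactor ‖v‖) x :=
      ((contDiffOn_conformalFactor (N := 1)).differentiableOn one_ne_zero).differentiableAt
        (isOpen_ball.mem_nhds hx)
    exact (hcf.pow l).smul (hf.differentiableAt.mul (hl.const_mul α))
  · refine (hc.smul ((hasDerivAt_omega_cpow_line h α i).mul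
      (hL.ofReal_comp.const_mul α))).congr_deriv ?_
    simp only [zero_smul, add_zero, Complex.real_smul, Pi.mul_apply]
    push_cast
    ring

/-- With `P = ρ² - |x|²` and `λ = 2ρ²/P`, the squared Euclidean gradient of `log ω` is `4ρ²/P²`, and
its weighted divergence `λ^(1-k) ∑ ∂ᵢ(λ^(k-1) ∂ᵢ log ω)` is `-4kρ²/P²`. Dividing `α(-4kρ² +
4αρ²)/P²` by `λ²` gives the constant `(α² - αk)/ρ²`. -/
theorem hypLaplacian_omega_cpow (hk : 1 ≤ k) (hρ : 0 < ρ) {v x : 𝔼} (hv : ‖v‖ = ρ)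
    (hx : x ∈ ball 0 ρ) (α : ℂ) :
    hypLaplacian ρ (fun y => (omega v y : ℂ) ^ α) x =
      -((α * (k : ℂ) - α ^ 2) / (ρ : ℂ) ^ 2) * (omega v x : ℂ) ^ α := by
  obtain ⟨l, rfl⟩ : ∃ l, k = l + 1 := ⟨k - 1, by omega⟩
  subst hv
  have h : ‖x‖ < ‖v‖ := by simpa using hx
  have h1 : 0 < ‖v‖ ^ 2 - ‖x‖ ^ 2 := sq_sub_norm_sq_pos hx
  have h2 : 0 < ‖v - x‖ ^ 2 := pow_pos (norm_sub_pos_of_norm_lt h) 2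
  rw [hypLaplacian_eq hk _ hx, Nat.add_sub_cancel]
  have hG : ∀ i, partialDeriv i (fun y => conformalFactor ‖v‖ y ^ l •
      partialDeriv i (fun y => (omega v y : ℂ) ^ α) y) x = _ := fun i =>
    (partialDeriv_congr (by
      filter_upwards [isOpen_ball.mem_nhds hx] with y hy
      rw [partialDeriv_omega_cpow (by simpa using hy)])).trans
    (partialDeriv_conformalFactor_pow_smul h α i l)
  simp only [hG]
  rw [← Finset.smul_sum, ← Finset.mul_sum, Finset.sum_add_distrib, ← Finset.mul_sum,
    ← Complex.ofReal_sum, ← Complex.ofReal_sum]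
  set P := ‖v‖ ^ 2 - ‖x‖ ^ 2 with hP
  set Q := ‖v - x‖ ^ 2 with hQ
  have sa : ∑ i, x i ^ 2 = ‖v‖ ^ 2 - P := by
    rw [hP, sub_sub_cancel, EuclideanSpace.real_norm_sq_eq]
  have sb : ∑ i, (v i - x i) ^ 2 = Q := by
    rw [hQ, EuclideanSpace.real_norm_sq_eq]; rfl
  -- Expansion of `|v|² = |x + (v - x)|²`; this is what removes `Q` from the two sums below.
  have sab : ∑ i, x i * (v i - x i) = (P - Q) / 2 := by
    have hv : ∑ i, v i ^ 2 = ‖v‖ ^ 2 := (EuclideanSpace.real_norm_sq_eq v).symm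
    have : ∑ i, v i ^ 2 = ∑ i, x i ^ 2 + ∑ i, (v i - x i) ^ 2 + 2 * ∑ i, x i * (v i - x i) := by
      rw [Finset.mul_sum, ← Finset.sum_add_distrib, ← Finset.sum_add_distrib]
      exact Finset.sum_congr rfl fun i _ => by ring
    rw [hv, sa, sb] at this
    linarith
  have sB : ∑ i, logOmegaDeriv v x i ^ 2 = 4 * ‖v‖ ^ 2 / P ^ 2 := by
    have : ∀ i, logOmegaDeriv v x i ^ 2 = 4 / P ^ 2 * x i ^ 2 - 8 / (P * Q) * (x i * (v i - x i)) +
        4 / Q ^ 2 * (v i - x i) ^ 2 := fun i => by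
      rw [logOmegaDeriv, ← hP, ← hQ]; field_simp; ring
    simp only [this]
    rw [Finset.sum_add_distrib, Finset.sum_sub_distrib, ← Finset.mul_sum, ← Finset.mul_sum,
      ← Finset.mul_sum, sa, sb, sab]
    field_simp
    ring
  have sA : ∑ i, (l * (2 * x i / P) * logOmegaDeriv v x i + logOmegaDerivDeriv v x i) =
      -4 * (l + 1) * ‖v‖ ^ 2 / P ^ 2 := by
    have : ∀ i, l * (2 * x i / P) * logOmegaDeriv v x i + logOmegaDerivDeriv v x i =
        (-4 * (l + 1) / P ^ 2) * x i ^ 2 + 4 * l / (P * Q) * (x i * (v i - x i)) +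
        4 / Q ^ 2 * (v i - x i) ^ 2 + (-2 / P - 2 / Q) := fun i => by
      rw [logOmegaDeriv, logOmegaDerivDeriv, ← hP, ← hQ]; field_simp; ring
    simp only [this]
    rw [Finset.sum_add_distrib, Finset.sum_add_distrib, Finset.sum_add_distrib, ← Finset.mul_sum,
      ← Finset.mul_sum, ← Finset.mul_sum, sa, sb, sab, Finset.sum_const, Finset.card_univ,
      Fintype.card_fin, nsmul_eq_mul]
    push_cast
    field_simp
    ring
  rw [sA, sB, conformalFactor, ← hP]
  have hρ' : (‖v‖ : ℂ) ≠ 0 := by exact_mod_cast hρ.ne'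
  have hP' : (P : ℂ) ≠ 0 := by exact_mod_cast h1.ne'
  simp only [Complex.real_smul]
  push_cast
  rw [pow_succ _ (l + 1), pow_succ]
  have hc : ((2 * (‖v‖ : ℂ) ^ 2) / P) ^ l ≠ 0 := pow_ne_zero _
    (div_ne_zero (mul_ne_zero two_ne_zero (pow_ne_zero 2 hρ')) hP')
  generalize ((2 * (‖v‖ : ℂ) ^ 2) / P) ^ l = c at *
  field_simp
  ring

end PoissonKernelPower

/-! ### The spherical mean as eigenfunction; reduction to a radial equation. -/

section Radial

variable {k : ℕ} {ρ : ℝ}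

local notation "𝔼" => EuclideanSpace ℝ (Fin (k + 1))

theorem contDiffOn_V_norm {u : 𝔼} (hu : ‖u‖ = ρ) (hρ : 0 < ρ) (α : ℂ) :
    ContDiffOn ℝ 2 (fun m : 𝔼 => V k u α ‖m‖) (ball 0 ρ) := by
  simp only [V_norm hu hρ]
  refine ContDiffOn.const_smul _ ?_
  exact contDiffOn_integral_param (n := 2)
    (H := fun p : 𝔼 × 𝔼 => (omega p.1 p.2 : ℂ) ^ α)
    (i := fun θ : sphere (0 : 𝔼) 1 => ρ • (θ : 𝔼))
    isOpen_setOf_norm_snd_lt (contDiffOn_omega_cpow α) (by fun_prop) isOpen_ball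
    fun θ y hy => by
      have : ‖y‖ < ρ := by simpa using hy
      simpa [norm_smul, abs_of_pos hρ] using this

theorem hypLaplacian_V_norm (hk : 1 ≤ k) {u m : 𝔼} (hu : ‖u‖ = ρ) (hm : m ∈ ball 0 ρ) (α : ℂ) :
    hypLaplacian ρ (fun m : 𝔼 => V k u α ‖m‖) m =
      -((α * (k : ℂ) - α ^ 2) / (ρ : ℂ) ^ 2) * V k u α ‖m‖ := by
  have hρ : 0 < ρ := (norm_nonneg m).trans_lt (by simpa using hm)
  simp only [V_norm hu hρ]
  rw [hypLaplacian_const_smul hk _ _ hm, mul_smul_comm]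
  congr 1
  have hn : ∀ θ : sphere (0 : 𝔼) 1, ‖ρ • (θ : 𝔼)‖ = ρ := fun θ => by
    simp [norm_smul, abs_of_pos hρ]
  rw [hypLaplacian_integral hk (H := fun p : 𝔼 × 𝔼 => (omega p.1 p.2 : ℂ) ^ α)
    (i := fun θ : sphere (0 : 𝔼) 1 => ρ • (θ : 𝔼)) isOpen_setOf_norm_snd_lt
    (contDiffOn_omega_cpow α) (by fun_prop) (fun θ y hy => by
      rw [mem_ofPred_eq, hn]; simpa using hy) hm, ← integral_const_mul]
  exact integral_congr_ae (Eventually.of_forall fun θ => hypLaplacian_omega_cpow hk hρ (hn θ) hm α)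

theorem hasDerivAt_norm_line {n : ℕ} {x : EuclideanSpace ℝ (Fin n)} (hx : x ≠ 0) (i : Fin n) :
    HasDerivAt (fun t : ℝ => ‖x + t • EuclideanSpace.single i (1 : ℝ)‖) (x i / ‖x‖) 0 := by
  have h0 : ‖x‖ ≠ 0 := norm_ne_zero_iff.2 hx
  have h := (hasDerivAt_sq_sub_norm_sq_line 0 x i).neg.sqrt (by simpa using h0)
  have he : (fun t : ℝ => ‖x + t • EuclideanSpace.single i (1 : ℝ)‖) = fun t : ℝ =>
      √((-fun t : ℝ => 0 ^ 2 - ‖x + t • EuclideanSpace.single i (1 : ℝ)‖ ^ 2) t) := by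
    ext t
    simp [Real.sqrt_sq (norm_nonneg _)]
  rw [he]
  refine h.congr_deriv ?_
  simp
  field_simp

theorem partialDeriv_comp_norm {n : ℕ} {g : ℝ → ℂ} {x : EuclideanSpace ℝ (Fin n)} (hx : x ≠ 0)
    {d : ℂ} (hg : HasDerivAt g d ‖x‖) (i : Fin n) :
    partialDeriv i (fun y => g ‖y‖) x = (x i / ‖x‖) • d := by
  refine partialDeriv_eq_of_hasDerivAt
    (hg.differentiableAt.comp x (differentiableAt_id.norm ℝ hx)) ?_
  refine HasDerivAt.scomp (h := fun t : ℝ => ‖x + t • EuclideanSpace.single i (1 : ℝ)‖)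
    (g₁ := g) 0 ?_ (hasDerivAt_norm_line hx i)
  simpa using hg

/-- The divergence of the field `y ↦ p(|y|) y / |y|ⁿ` is `|y|¹⁻ⁿ` times the derivative of `p`
at `|y|`. -/
theorem sum_partialDeriv_radial {p : ℝ → ℂ} {x : 𝔼} (hx : x ≠ 0) {d : ℂ}
    (hp : HasDerivAt p d ‖x‖) :
    ∑ i, partialDeriv i (fun y : 𝔼 => (y i / ‖y‖ ^ (k + 1)) • p ‖y‖) x = (‖x‖ ^ k)⁻¹ • d := by
  have h0 : ‖x‖ ≠ 0 := norm_ne_zero_iff.2 hx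
  have hi : ∀ i, partialDeriv i (fun y : 𝔼 => (y i / ‖y‖ ^ (k + 1)) • p ‖y‖) x =
      (x i ^ 2 / ‖x‖ ^ (k + 2)) • d +
        (1 / ‖x‖ ^ (k + 1) - (k + 1) / ‖x‖ ^ (k + 3) * x i ^ 2) • p ‖x‖ := fun i => by
    have hn := hasDerivAt_norm_line hx i
    have hc : HasDerivAt (fun t : ℝ => (x + t • EuclideanSpace.single i (1 : ℝ)) i) 1 0 := by
      simpa using (hasDerivAt_id (0 : ℝ)).const_add (x i)
    have hpn : HasDerivAt (fun t : ℝ => p ‖x + t • EuclideanSpace.single i (1 : ℝ)‖)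
        ((x i / ‖x‖) • d) 0 :=
      HasDerivAt.scomp (h := fun t : ℝ => ‖x + t • EuclideanSpace.single i (1 : ℝ)‖)
        (g₁ := p) 0 (by simpa using hp) hn
    refine partialDeriv_eq_of_hasDerivAt ?_ ?_
    · have h1 : DifferentiableAt ℝ (fun y : 𝔼 => y i) x := by fun_prop
      have h2 : DifferentiableAt ℝ (fun y : 𝔼 => ‖y‖) x := differentiableAt_id.norm ℝ hx
      have h3 : DifferentiableAt ℝ (fun y : 𝔼 => ‖y‖ ^ (k + 1)) x := h2.pow (k + 1)
      have h4 : DifferentiableAt ℝ (fun y : 𝔼 => y i / ‖y‖ ^ (k + 1)) x := by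
        simp only [div_eq_mul_inv]
        exact h1.fun_mul (h3.fun_inv (pow_ne_zero _ h0))
      exact h4.smul (hp.differentiableAt.comp x h2)
    · refine ((hc.div (hn.pow (k + 1)) (by simpa using h0)).smul hpn).congr_deriv ?_
      simp only [zero_smul, add_zero, Pi.div_apply, Pi.pow_apply, smul_smul]
      congr 2
      · field_simp
        ring
      · push_cast
        field_simp
        ring
  simp only [hi]
  have hs : ∑ i, x i ^ 2 = ‖x‖ ^ 2 := (EuclideanSpace.real_norm_sq_eq x).symm
  rw [Finset.sum_add_distrib, ← Finset.sum_smul, ← Finset.sum_smul, ← Finset.sum_div,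
    Finset.sum_sub_distrib, ← Finset.mul_sum, hs, Finset.sum_const, Finset.card_univ,
    Fintype.card_fin, nsmul_eq_mul]
  have h1 : ((k + 1 : ℕ) : ℝ) * (1 / ‖x‖ ^ (k + 1)) - (k + 1) / ‖x‖ ^ (k + 3) * ‖x‖ ^ 2 = 0 := by
    push_cast
    field_simp
    ring
  have h2 : ‖x‖ ^ 2 / ‖x‖ ^ (k + 2) = (‖x‖ ^ k)⁻¹ := by
    field_simp
    ring
  rw [h1, h2, zero_smul, add_zero]

/-- The radial weight `tᵏ (2 ρ² / (ρ² - t²))ˡ`. -/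
noncomputable def radialWeight (ρ : ℝ) (k l : ℕ) (t : ℝ) : ℝ :=
  t ^ k * (2 * ρ ^ 2 / (ρ ^ 2 - t ^ 2)) ^ l

theorem sq_sub_sq_pos_of_mem_Ioo {t : ℝ} (ht : t ∈ Ioo 0 ρ) : 0 < ρ ^ 2 - t ^ 2 := by
  nlinarith [ht.1, ht.2]

theorem radialWeight_pos {l : ℕ} {t : ℝ} (ht : t ∈ Ioo 0 ρ) : 0 < radialWeight ρ k l t := by
  have h1 := ht.1
  have h2 := h1.trans ht.2
  have := sq_sub_sq_pos_of_mem_Ioo ht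
  rw [radialWeight]
  positivity

theorem contDiffOn_radialWeight {l : ℕ} {N : WithTop ℕ∞} :
    ContDiffOn ℝ N (radialWeight ρ k l) (Ioo 0 ρ) := by
  refine (contDiffOn_id.pow k).mul ((contDiffOn_const.div ?_ ?_).pow l)
  · fun_prop
  · exact fun t ht => (sq_sub_sq_pos_of_mem_Ioo ht).ne'

/-- Restriction to a coordinate ray, on which the norm is the parameter. -/
theorem contDiffOn_of_contDiffOn_norm {g : ℝ → ℂ} {N : WithTop ℕ∞}
    (hg : ContDiffOn ℝ N (fun m : 𝔼 => g ‖m‖) (ball 0 ρ \ {0})) :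
    ContDiffOn ℝ N g (Ioo 0 ρ) := by
  have hl : ContDiff ℝ N fun t : ℝ => t • EuclideanSpace.single (0 : Fin (k + 1)) (1 : ℝ) := by
    fun_prop
  have hn : ∀ t ∈ Ioo 0 ρ, ‖t • EuclideanSpace.single (0 : Fin (k + 1)) (1 : ℝ)‖ = t := by
    intro t ht
    rw [norm_smul, PiLp.norm_single, norm_one, mul_one, Real.norm_of_nonneg ht.1.le]
  refine (hg.comp hl.contDiffOn fun t ht => ⟨?_, ?_⟩).congr fun t ht => ?_
  · simpa [hn t ht] using ht.2
  · rw [mem_singleton_iff, ← norm_eq_zero, hn t ht]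
    exact ht.1.ne'
  · simp only [Function.comp_apply, hn t ht]

/-- A radial eigenfunction satisfies the radial Sturm–Liouville equation. -/
theorem hasDerivAt_radialWeight_smul_deriv (hk : 1 ≤ k) {g : ℝ → ℂ} {μ : ℂ}
    (hg : ContDiffOn ℝ 2 (fun m : 𝔼 => g ‖m‖) (ball 0 ρ \ {0}))
    (heq : ∀ m ∈ ball (0 : 𝔼) ρ \ {0}, hypLaplacian ρ (fun x : 𝔼 => g ‖x‖) m + μ * g ‖m‖ = 0)
    {t : ℝ} (ht : t ∈ Ioo 0 ρ) :
    HasDerivAt (fun s => radialWeight ρ k (k - 1) s • deriv g s)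
      (-(radialWeight ρ k (k + 1) t * μ) * g t) t := by
  have hg2 := contDiffOn_of_contDiffOn_norm hg
  have hdg : ∀ s ∈ Ioo 0 ρ, HasDerivAt g (deriv g s) s := fun s hs =>
    ((hg2.differentiableOn two_ne_zero).differentiableAt (isOpen_Ioo.mem_nhds hs)).hasDerivAt
  set p := fun s => radialWeight ρ k (k - 1) s • deriv g s with hp
  have hpd : HasDerivAt p (deriv p t) t := by
    have hd : ContDiffOn ℝ 1 (deriv g) (Ioo 0 ρ) := hg2.deriv_of_isOpen isOpen_Ioo (by norm_num)
    have : ContDiffOn ℝ 1 p (Ioo 0 ρ) := contDiffOn_radialWeight.smul hd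
    exact ((this.differentiableOn one_ne_zero).differentiableAt
      (isOpen_Ioo.mem_nhds ht)).hasDerivAt
  refine hpd.congr_deriv ?_
  set x : 𝔼 := t • EuclideanSpace.single (0 : Fin (k + 1)) (1 : ℝ)
  have hn : ‖x‖ = t := by
    rw [norm_smul, PiLp.norm_single, norm_one, mul_one, Real.norm_of_nonneg ht.1.le]
  have hx0 : x ≠ 0 := norm_ne_zero_iff.1 (hn ▸ ht.1.ne')
  have hxb : x ∈ ball (0 : 𝔼) ρ := by simpa [hn] using ht.2
  -- The weighted gradient `λ^(k-1) ∇g(|y|)` is the radial field `p(|y|) y/|y|^(k+1)`, whose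
  -- divergence is known.
  have hlap : hypLaplacian ρ (fun x : 𝔼 => g ‖x‖) x =
      (conformalFactor ρ x ^ (k + 1))⁻¹ • (‖x‖ ^ k)⁻¹ • deriv p t := by
    rw [hypLaplacian_eq hk _ hxb]
    congr 1
    rw [← sum_partialDeriv_radial (p := p) hx0 (by rwa [hn])]
    refine Finset.sum_congr rfl fun i _ => partialDeriv_congr ?_
    filter_upwards [(isOpen_ball.sdiff isClosed_singleton).mem_nhds
      (⟨hxb, hx0⟩ : x ∈ ball (0 : 𝔼) ρ \ {0})] with y hy
    have hy0 : ‖y‖ ≠ 0 := norm_ne_zero_iff.2 hy.2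
    have hy1 : ‖y‖ ∈ Ioo 0 ρ := ⟨norm_pos_iff.2 hy.2, by simpa using hy.1⟩
    rw [partialDeriv_comp_norm hy.2 (hdg _ hy1)]
    simp only [hp, radialWeight, conformalFactor, smul_smul]
    congr 1
    generalize (2 * ρ ^ 2 / (ρ ^ 2 - ‖y‖ ^ 2)) ^ (k - 1) = c
    field_simp
    ring
  have h := heq x ⟨hxb, hx0⟩
  have hc : (conformalFactor ρ x : ℂ) ≠ 0 := by exact_mod_cast (conformalFactor_pos hxb).ne'
  have htc : (t : ℂ) ≠ 0 := by exact_mod_cast ht.1.ne'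
  rw [hlap, hn] at h
  simp only [Complex.real_smul] at h
  have hw : radialWeight ρ k (k + 1) t = t ^ k * conformalFactor ρ x ^ (k + 1) := by
    rw [radialWeight, conformalFactor, hn]
  rw [hw]
  push_cast at h ⊢
  field_simp at h
  linear_combination h

end Radial

/-! ### Uniqueness for a Sturm–Liouville equation singular at `0`. -/

section SturmLiouville

variable {a b : ℝ} {w : ℝ → ℝ} {q g g' v v' : ℝ → ℂ}

theorem wronskian_const
    (hg : ∀ t ∈ Ioo a b, HasDerivAt g (g' t) t)
    (hpg : ∀ t ∈ Ioo a b, HasDerivAt (fun s => w s • g' s) (-q t * g t) t)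
    (hv : ∀ t ∈ Ioo a b, HasDerivAt v (v' t) t)
    (hpv : ∀ t ∈ Ioo a b, HasDerivAt (fun s => w s • v' s) (-q t * v t) t) :
    ∃ C : ℂ, ∀ t ∈ Ioo a b, w t * (g' t * v t - g t * v' t) = C := by
  have hd : ∀ t ∈ Ioo a b,
      HasDerivAt (fun s => (w s • g' s) * v s - g s * (w s • v' s)) 0 t := fun t ht => by
    refine (((hpg t ht).mul (hv t ht)).sub ((hg t ht).mul (hpv t ht))).congr_deriv ?_
    simp only [Complex.real_smul]
    ring
  obtain ⟨C, hC⟩ := isOpen_Ioo.exists_is_const_of_deriv_eq_zero isPreconnected_Ioo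
    (fun t ht => (hd t ht).differentiableAt.differentiableWithinAt) fun t ht => (hd t ht).deriv
  refine ⟨C, fun t ht => ?_⟩
  rw [← hC t ht]
  simp only [Complex.real_smul]
  ring

/-- A function on `(0, δ)` whose derivative is `C / (w z)`, with `z → 1` and `w` of order at most
`t` at `0`, has no limit at `0` unless `C = 0`. -/
theorem eq_zero_of_tendsto_of_hasDerivAt_div {δ K : ℝ} (hδ : 0 < δ) {h z : ℝ → ℂ} {C l : ℂ}
    (hw : ∀ t ∈ Ioo 0 δ, 0 < w t) (hwK : ∀ t ∈ Ioo 0 δ, w t ≤ K * t)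
    (hz : ∀ t ∈ Ioo 0 δ, 1 / 2 ≤ ((z t)⁻¹).re)
    (hh : ∀ t ∈ Ioo 0 δ, HasDerivAt h (C / (w t * z t)) t)
    (hl : Tendsto h (𝓝[>] 0) (𝓝 l)) : C = 0 := by
  by_contra hC
  have hCn : 0 < ‖C‖ ^ 2 := by positivity
  have hK : 0 < K := by
    have hm : δ / 2 ∈ Ioo 0 δ := ⟨by linarith, by linarith⟩
    have := (hw _ hm).trans_le (hwK _ hm)
    exact pos_of_mul_pos_left this (by linarith)
  -- Multiplying `h` by the conjugate of `C` makes the real part of the derivative at least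
  -- `|C|²/(2Kt) = κ/t`. So `Re(C̄h) - κ log` increases, yet it tends to `+∞` at `0⁺`, since `h` has
  -- a limit: a contradiction.
  set κ := ‖C‖ ^ 2 / (2 * K) with hκ
  have hκ0 : 0 < κ := by positivity
  have hR : ∀ t ∈ Ioo 0 δ, HasDerivAt (fun s => (starRingEnd ℂ C * h s).re - κ * Real.log s)
      (‖C‖ ^ 2 / w t * ((z t)⁻¹).re - κ * t⁻¹) t := fun t ht => by
    have h1 : HasDerivAt (fun s => (starRingEnd ℂ C * h s).re)
        (starRingEnd ℂ C * (C / (w t * z t))).re t :=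
      Complex.reCLM.hasFDerivAt.comp_hasDerivAt t ((hh t ht).const_mul _)
    refine (h1.sub ((Real.hasDerivAt_log ht.1.ne').const_mul κ)).congr_deriv ?_
    congr 1
    have : starRingEnd ℂ C * (C / (w t * z t)) = ((‖C‖ ^ 2 / w t : ℝ) : ℂ) * (z t)⁻¹ := by
      rw [← mul_div_assoc, Complex.conj_mul']
      push_cast
      rw [div_mul_eq_div_div, div_eq_mul_inv _ (z t)]
    rw [this, Complex.re_ofReal_mul]
  have hmono : MonotoneOn (fun s => (starRingEnd ℂ C * h s).re - κ * Real.log s) (Ioo 0 δ) := by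
    refine monotoneOn_of_deriv_nonneg (convex_Ioo _ _)
      (fun t ht => (hR t ht).continuousAt.continuousWithinAt) ?_ ?_
    · rw [interior_Ioo]
      exact fun t ht => (hR t ht).differentiableAt.differentiableWithinAt
    · rw [interior_Ioo]
      intro t ht
      rw [(hR t ht).deriv]
      have ht0 := ht.1
      have h1 : κ * t⁻¹ = ‖C‖ ^ 2 / (K * t) * (1 / 2) := by
        rw [hκ]; field_simp
      have h2 : ‖C‖ ^ 2 / (K * t) * (1 / 2) ≤ ‖C‖ ^ 2 / w t * ((z t)⁻¹).re := by
        have := hw t ht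
        gcongr
        · exact hwK t ht
        · exact hz t ht
      linarith
  have htop : Tendsto (fun s => (starRingEnd ℂ C * h s).re - κ * Real.log s) (𝓝[>] 0) atTop := by
    have h1 : Tendsto (fun s => (starRingEnd ℂ C * h s).re) (𝓝[>] 0)
        (𝓝 (starRingEnd ℂ C * l).re) :=
      (Complex.continuous_re.tendsto _).comp (hl.const_mul _)
    have h2 : Tendsto (fun s => -(κ * Real.log s)) (𝓝[>] 0) atTop :=
      tendsto_neg_atBot_atTop.comp (Real.tendsto_log_nhdsGT_zero.const_mul_atBot hκ0)
    simpa only [sub_eq_add_neg] using h1.add_atTop h2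
  have hm : δ / 2 ∈ Ioo 0 δ := ⟨by linarith, by linarith⟩
  have hev := htop.eventually_gt_atTop ((starRingEnd ℂ C * h (δ / 2)).re - κ * Real.log (δ / 2))
  obtain ⟨t, ht1, ht2⟩ := (hev.and (Ioo_mem_nhdsGT hm.1)).exists
  exact absurd (hmono ⟨ht2.1, ht2.2.trans hm.2⟩ hm ht2.2.le) (not_le.2 ht1)

/-- Away from the singularity the pair `(g, w g')` solves a linear first-order system with bounded
coefficients, so Lipschitz uniqueness applies. Taking `w g'` as the second unknown avoids
differentiating `w`. -/
theorem sturmLiouville_eqOn_Icc (hab : a ≤ b) (hw : ContinuousOn w (Icc a b))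
    (hw0 : ∀ t ∈ Icc a b, 0 < w t) (hq : ContinuousOn q (Icc a b))
    (hg : ∀ t ∈ Icc a b, HasDerivAt g (g' t) t)
    (hpg : ∀ t ∈ Icc a b, HasDerivAt (fun s => w s • g' s) (-q t * g t) t)
    (hv : ∀ t ∈ Icc a b, HasDerivAt v (v' t) t)
    (hpv : ∀ t ∈ Icc a b, HasDerivAt (fun s => w s • v' s) (-q t * v t) t)
    (h0 : g a = v a) (h1 : g' a = v' a) : EqOn g v (Icc a b) := by
  obtain ⟨K₁, hK₁⟩ := isCompact_Icc.exists_bound_of_continuousOn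
    (hw.inv₀ fun t ht => (hw0 t ht).ne')
  obtain ⟨K₂, hK₂⟩ := isCompact_Icc.exists_bound_of_continuousOn hq
  have hK₁0 : 0 ≤ K₁ := (norm_nonneg _).trans (hK₁ a ⟨le_rfl, hab⟩)
  have hlip : ∀ t ∈ Ico a b, LipschitzOnWith (max K₁ K₂).toNNReal
      (fun Y : ℂ × ℂ => ((w t)⁻¹ • Y.2, -q t * Y.1)) univ := fun t ht => by
    have ht' := Ico_subset_Icc_self ht
    refine LipschitzOnWith.of_dist_le_mul fun Y _ Z _ => ?_
    rw [Real.coe_toNNReal _ (hK₁0.trans (le_max_left _ _)), dist_eq_norm, dist_eq_norm,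
      Prod.mk_sub_mk, ← smul_sub, ← mul_sub, Prod.norm_def]
    refine max_le ?_ ?_
    · rw [norm_smul]
      exact mul_le_mul ((hK₁ t ht').trans (le_max_left _ _)) (norm_snd_le (Y - Z))
        (norm_nonneg _) (hK₁0.trans (le_max_left _ _))
    · rw [norm_mul, norm_neg]
      exact mul_le_mul ((hK₂ t ht').trans (le_max_right _ _)) (norm_fst_le (Y - Z))
        (norm_nonneg _) (hK₁0.trans (le_max_left _ _))
  have hsys : ∀ {f f' : ℝ → ℂ}, (∀ t ∈ Icc a b, HasDerivAt f (f' t) t) →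
      (∀ t ∈ Icc a b, HasDerivAt (fun s => w s • f' s) (-q t * f t) t) →
      ∀ t ∈ Icc a b, HasDerivAt (fun s => (f s, w s • f' s))
        ((w t)⁻¹ • (w t • f' t), -q t * f t) t := fun hf hpf t ht => by
    rw [smul_smul, inv_mul_cancel₀ (hw0 t ht).ne', one_smul]
    exact (hf t ht).prodMk (hpf t ht)
  have := ODE_solution_unique_of_mem_Icc_right (s := fun _ => univ) hlip
    (fun t ht => (hsys hg hpg t ht).continuousAt.continuousWithinAt)
    (fun t ht => (hsys hg hpg t (Ico_subset_Icc_self ht)).hasDerivWithinAt) (fun _ _ => trivial)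
    (fun t ht => (hsys hv hpv t ht).continuousAt.continuousWithinAt)
    (fun t ht => (hsys hv hpv t (Ico_subset_Icc_self ht)).hasDerivWithinAt) (fun _ _ => trivial)
    (by simp only [h0, h1])
  exact fun t ht => congrArg Prod.fst (this ht)

/-- The Sturm–Liouville equation `D (w D g) + q g = 0` on `(0, b)`, where `w`
vanishes at least to first order at `0`, has at most one solution that tends to `1` at `0`. -/
theorem sturmLiouville_unique {K ε : ℝ} (hε : 0 < ε) (hεb : ε ≤ b)
    (hw : ContinuousOn w (Ioo 0 b)) (hw0 : ∀ t ∈ Ioo 0 b, 0 < w t)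
    (hwK : ∀ t ∈ Ioo 0 ε, w t ≤ K * t) (hq : ContinuousOn q (Ioo 0 b))
    (hg : ∀ t ∈ Ioo 0 b, HasDerivAt g (g' t) t)
    (hpg : ∀ t ∈ Ioo 0 b, HasDerivAt (fun s => w s • g' s) (-q t * g t) t)
    (hv : ∀ t ∈ Ioo 0 b, HasDerivAt v (v' t) t)
    (hpv : ∀ t ∈ Ioo 0 b, HasDerivAt (fun s => w s • v' s) (-q t * v t) t)
    (hg1 : Tendsto g (𝓝[>] 0) (𝓝 1)) (hv1 : Tendsto v (𝓝[>] 0) (𝓝 1)) :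
    EqOn g v (Ioo 0 b) := by
  obtain ⟨C, hC⟩ := wronskian_const hg hpg hv hpv
  have hz : Tendsto (fun t => ((v t ^ 2)⁻¹).re) (𝓝[>] 0) (𝓝 1) := by
    have : Tendsto (fun t => (v t ^ 2)⁻¹) (𝓝[>] 0) (𝓝 1) := by
      simpa using (hv1.pow 2).inv₀ (by simp)
    exact (Complex.continuous_re.tendsto _).comp this
  have hev : ∀ᶠ t in 𝓝[>] (0 : ℝ), 1 / 2 < ((v t ^ 2)⁻¹).re ∧ v t ≠ 0 :=
    (hz.eventually (lt_mem_nhds (by norm_num))).and (hv1.eventually_ne one_ne_zero)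
  obtain ⟨δ₀, hδ₀, hsub⟩ := mem_nhdsGT_iff_exists_Ioo_subset.1 hev
  set δ := min δ₀ ε with hδ
  have hδ0 : 0 < δ := lt_min hδ₀ hε
  have hδb : Ioo 0 δ ⊆ Ioo 0 b := Ioo_subset_Ioo_right ((min_le_right _ _).trans hεb)
  have hnear : ∀ t ∈ Ioo 0 δ, 1 / 2 < ((v t ^ 2)⁻¹).re ∧ v t ≠ 0 := fun t ht =>
    hsub ⟨ht.1, ht.2.trans_le (min_le_left _ _)⟩
  -- The quotient rule produces the Wronskian over `v²`; this is confined to `(0, δ)`, where `v` has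
  -- no zero.
  have hquot : ∀ t ∈ Ioo 0 δ, HasDerivAt (fun s => g s / v s) (C / (w t * v t ^ 2)) t :=
    fun t ht => by
    have h1 := hδb ht
    refine ((hg t h1).div (hv t h1) (hnear t ht).2).congr_deriv ?_
    rw [← hC t h1]
    have : (w t : ℂ) ≠ 0 := by exact_mod_cast (hw0 t h1).ne'
    rw [mul_div_mul_left _ _ this]
  have hlim : Tendsto (fun s => g s / v s) (𝓝[>] 0) (𝓝 1) := by
    simpa [Pi.div_def] using hg1.div hv1 one_ne_zero
  have hC0 : C = 0 := eq_zero_of_tendsto_of_hasDerivAt_div hδ0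
    (fun t ht => hw0 t (hδb ht)) (fun t ht => hwK t ⟨ht.1, ht.2.trans_le (min_le_right _ _)⟩)
    (fun t ht => (hnear t ht).1.le) hquot hlim
  obtain ⟨D, hD⟩ := isOpen_Ioo.exists_is_const_of_deriv_eq_zero isPreconnected_Ioo
    (fun t ht => (hquot t ht).differentiableAt.differentiableWithinAt)
    fun t ht => by rw [(hquot t ht).deriv, hC0, zero_div]; rfl
  have hD1 : D = 1 := by
    refine tendsto_nhds_unique (tendsto_const_nhds.congr' ?_) hlim
    filter_upwards [Ioo_mem_nhdsGT hδ0] with t ht using (hD t ht).symm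
  have hsmall : EqOn g v (Ioo 0 δ) := fun t ht => by
    have := hD t ht
    rwa [hD1, div_eq_one_iff_eq (hnear t ht).2] at this
  intro t ht
  rcases lt_or_ge t (δ / 2) with h | h
  · exact hsmall ⟨ht.1, h.trans (by linarith)⟩
  -- Further out `v` may vanish. The solutions share value and derivative at `δ/2`, so the regular
  -- equation carries the equality on.
  · have hm : δ / 2 ∈ Ioo 0 δ := ⟨by linarith, by linarith⟩
    have hsubt : Icc (δ / 2) t ⊆ Ioo 0 b := Icc_subset_Ioo hm.1 ht.2
    have hder : g' (δ / 2) = v' (δ / 2) :=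
      (hg _ (hδb hm)).unique ((hv _ (hδb hm)).congr_of_eventuallyEq
        (hsmall.eventuallyEq_of_mem (isOpen_Ioo.mem_nhds hm)))
    exact sturmLiouville_eqOn_Icc h (hw.mono hsubt) (fun s hs => hw0 s (hsubt hs))
      (hq.mono hsubt) (fun s hs => hg s (hsubt hs)) (fun s hs => hpg s (hsubt hs))
      (fun s hs => hv s (hsubt hs)) (fun s hs => hpv s (hsubt hs)) (hsmall hm) hder ⟨h, le_rfl⟩

end SturmLiouville

/-! ### Uniqueness of radial eigenfunctions; return to the hyperbolic distance. -/

section Uniqueness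

variable {k : ℕ} {ρ : ℝ}

local notation "𝔼" => EuclideanSpace ℝ (Fin (k + 1))

theorem radialWeight_le_mul {l : ℕ} (hk : 1 ≤ k) (hρ : 0 < ρ) {t : ℝ} (ht : t ∈ Ioo 0 (ρ / 2)) :
    radialWeight ρ k l t ≤ (ρ ^ (k - 1) * (8 / 3) ^ l) * t := by
  obtain ⟨j, rfl⟩ : ∃ j, k = j + 1 := ⟨k - 1, by omega⟩
  have h0 := ht.1
  have h1 : t ≤ ρ := by linarith [ht.2]
  have h2 : 0 < ρ ^ 2 - t ^ 2 := sq_sub_sq_pos_of_mem_Ioo ⟨h0, by linarith [ht.2]⟩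
  -- `8/3` is the value at `t = ρ/2`.
  have h3 : 2 * ρ ^ 2 / (ρ ^ 2 - t ^ 2) ≤ 8 / 3 := by
    rw [div_le_div_iff₀ h2 (by norm_num)]
    nlinarith [ht.2]
  rw [radialWeight, Nat.add_sub_cancel, pow_succ, mul_right_comm]
  gcongr

/-- Two radial eigenfunctions on the punctured ball with the same eigenvalue agree if both tend
to `1` at the origin. -/
theorem eqOn_of_radial_eigenfunction (hk : 1 ≤ k) (hρ : 0 < ρ) {μ : ℂ} {g v : ℝ → ℂ}
    (hg : ContDiffOn ℝ 2 (fun m : 𝔼 => g ‖m‖) (ball 0 ρ \ {0}))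
    (hge : ∀ m ∈ ball (0 : 𝔼) ρ \ {0}, hypLaplacian ρ (fun x : 𝔼 => g ‖x‖) m + μ * g ‖m‖ = 0)
    (hv : ContDiffOn ℝ 2 (fun m : 𝔼 => v ‖m‖) (ball 0 ρ \ {0}))
    (hve : ∀ m ∈ ball (0 : 𝔼) ρ \ {0}, hypLaplacian ρ (fun x : 𝔼 => v ‖x‖) m + μ * v ‖m‖ = 0)
    (hg1 : Tendsto g (𝓝[>] 0) (𝓝 1)) (hv1 : Tendsto v (𝓝[>] 0) (𝓝 1)) :
    EqOn g v (Ioo 0 ρ) := by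
  have hd : ∀ {f : ℝ → ℂ}, ContDiffOn ℝ 2 (fun m : 𝔼 => f ‖m‖) (ball 0 ρ \ {0}) →
      ∀ t ∈ Ioo 0 ρ, HasDerivAt f (deriv f t) t := fun hf t ht =>
    (((contDiffOn_of_contDiffOn_norm hf).differentiableOn two_ne_zero).differentiableAt
      (isOpen_Ioo.mem_nhds ht)).hasDerivAt
  refine sturmLiouville_unique (w := radialWeight ρ k (k - 1)) (ε := ρ / 2)
    (q := fun t => radialWeight ρ k (k + 1) t * μ) (half_pos hρ) (half_le_self hρ.le)
    (contDiffOn_radialWeight (N := 0)).continuousOn (fun t ht => radialWeight_pos ht)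
    (fun t ht => radialWeight_le_mul hk hρ ht) ?_ (hd hg)
    (fun t ht => hasDerivAt_radialWeight_smul_deriv hk hg hge ht) (hd hv)
    (fun t ht => hasDerivAt_radialWeight_smul_deriv hk hv hve ht) hg1 hv1
  exact (Complex.continuous_ofReal.comp_continuousOn
    (contDiffOn_radialWeight (N := 0)).continuousOn).mul continuousOn_const

end Uniqueness

theorem exists_hypDist_zero_eq {k : ℕ} {ρ r : ℝ} (hρ : 0 < ρ) (hr : 0 ≤ r) :
    ∃ m : EuclideanSpace ℝ (Fin (k + 1)), m ∈ ball 0 ρ ∧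
      ‖m‖ = ρ * Real.tanh (r / (2 * ρ)) ∧ hypDist ρ 0 m = r := by
  set η := ρ * Real.tanh (r / (2 * ρ)) with hη
  have h0 : 0 ≤ η := by
    rw [hη, Real.tanh_eq_sinh_div_cosh]
    have := Real.sinh_nonneg_iff.2 (show 0 ≤ r / (2 * ρ) by positivity)
    have := Real.cosh_pos (r / (2 * ρ))
    positivity
  have hn : ‖EuclideanSpace.single (0 : Fin (k + 1)) η‖ = η := by
    rw [PiLp.norm_single, Real.norm_of_nonneg h0]
  have hlt : η < ρ := mul_lt_of_lt_one_right hρ (Real.tanh_lt_one _)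
  have hm : EuclideanSpace.single (0 : Fin (k + 1)) η ∈ ball 0 ρ := by simpa [hn] using hlt
  refine ⟨_, hm, hn, ?_⟩
  rw [hypDist_zero_left hm, hn, hη, mul_div_cancel_left₀ _ hρ.ne', Real.artanh_tanh]
  field_simp

/-- Approaching the origin along a ray gives the one-sided limit that uniqueness needs, both for
`V_α` and for a solution on the unpunctured ball. -/
theorem tendsto_of_continuousAt_comp_norm {k : ℕ} {f : ℝ → ℂ}
    (hf : ContinuousAt (fun m : EuclideanSpace ℝ (Fin (k + 1)) => f ‖m‖) 0) :
    Tendsto f (𝓝[>] 0) (𝓝 (f 0)) := by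
  have hc : Continuous fun t : ℝ => t • EuclideanSpace.single (0 : Fin (k + 1)) (1 : ℝ) := by
    fun_prop
  have h0 : Tendsto (fun t : ℝ => t • EuclideanSpace.single (0 : Fin (k + 1)) (1 : ℝ)) (𝓝[>] 0)
      (𝓝 0) := by
    simpa using (hc.tendsto 0).mono_left nhdsWithin_le_nhds
  have h1 := hf.tendsto.comp h0
  rw [norm_zero] at h1
  refine h1.congr' ?_
  filter_upwards [self_mem_nhdsWithin] with t ht
  have ht' : 0 < t := ht
  simp [norm_smul, abs_of_pos ht']

section Eigenfunction

variable {k : ℕ} {ρ : ℝ} {μ : ℂ}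

/-- The formula for the distance holds in the ball only, which suffices because the Laplacian at a
point depends only on the germ there. -/
theorem isRadialEigenfunctionOn_iff (hk : 1 ≤ k) {Ω : Set (EuclideanSpace ℝ (Fin (k + 1)))}
    (hΩ : Ω ⊆ ball 0 ρ) {ψ g : ℝ → ℂ}
    (h : ∀ m ∈ ball (0 : EuclideanSpace ℝ (Fin (k + 1))) ρ, ψ (hypDist ρ 0 m) = g ‖m‖) :
    IsRadialEigenfunctionOn k ρ μ Ω ψ ↔
      ContDiffOn ℝ 2 (fun m : EuclideanSpace ℝ (Fin (k + 1)) => g ‖m‖) Ω ∧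
        ∀ m ∈ Ω, hypLaplacian ρ (fun x : EuclideanSpace ℝ (Fin (k + 1)) => g ‖x‖) m +
          μ * g ‖m‖ = 0 := by
  refine and_congr (contDiffOn_congr fun m hm => h m (hΩ hm)) (forall₂_congr fun m hm => ?_)
  rw [h m (hΩ hm), hypLaplacian_congr hk (hΩ hm)]
  filter_upwards [isOpen_ball.mem_nhds (hΩ hm)] with x hx using h x hx

theorem V_zero {u : EuclideanSpace ℝ (Fin (k + 1))} (hu : ‖u‖ = ρ) (hρ : 0 < ρ) (α : ℂ) :
    V k u α 0 = 1 := by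
  simp [V, sphericalMean, omega, hu, hρ.ne']

/-- A radial eigenfunction on the punctured ball that tends to `1` at the origin is the spherical
mean `V_α`. -/
theorem eq_V_of_isRadialEigenfunctionOn (hk : 1 ≤ k) (hρ : 0 < ρ)
    {u : EuclideanSpace ℝ (Fin (k + 1))} (hu : ‖u‖ = ρ) {α : ℂ}
    (hμ : μ = (α * (k : ℂ) - α ^ 2) / (ρ : ℂ) ^ 2) {ψ : ℝ → ℂ}
    (hψ : IsRadialEigenfunctionOn k ρ μ (ball 0 ρ \ {0}) ψ) (hψ0 : ψ 0 = 1)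
    (hlim : Tendsto (fun t => ψ (2 * ρ * Real.artanh (t / ρ))) (𝓝[>] 0) (𝓝 1))
    {r : ℝ} (hr : 0 ≤ r) : ψ r = V k u α (ρ * Real.tanh (r / (2 * ρ))) := by
  obtain ⟨hg, hge⟩ := (isRadialEigenfunctionOn_iff hk sdiff_subset
    (g := fun t => ψ (2 * ρ * Real.artanh (t / ρ)))
    fun m hm => by rw [hypDist_zero_left hm]).1 hψ
  have hVlim : Tendsto (V k u α) (𝓝[>] 0) (𝓝 1) := by
    have h := tendsto_of_continuousAt_comp_norm
      ((contDiffOn_V_norm hu hρ α).continuousOn.continuousAt (ball_mem_nhds _ hρ))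
    rwa [V_zero hu hρ] at h
  have hVe : ∀ m ∈ ball (0 : EuclideanSpace ℝ (Fin (k + 1))) ρ \ {0},
      hypLaplacian ρ (fun x : EuclideanSpace ℝ (Fin (k + 1)) => V k u α ‖x‖) m +
        μ * V k u α ‖m‖ = 0 := fun m hm => by
    rw [hypLaplacian_V_norm hk hu hm.1, hμ]
    ring
  have heq := eqOn_of_radial_eigenfunction (g := fun t => ψ (2 * ρ * Real.artanh (t / ρ)))
    (v := V k u α) hk hρ hg hge ((contDiffOn_V_norm hu hρ α).mono sdiff_subset) hVe hlim hVlim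
  rcases hr.eq_or_lt with rfl | hr'
  · simp [hψ0, V_zero hu hρ]
  · obtain ⟨m, hm, hn, hd⟩ := exists_hypDist_zero_eq (k := k) hρ hr
    have hm0 : 0 < ‖m‖ := by
      refine norm_pos_iff.2 fun h => hr'.ne' ?_
      rw [← hd, h, hypDist_zero_left (by simpa using hρ)]
      simp
    have h : ψ (2 * ρ * Real.artanh (‖m‖ / ρ)) = V k u α ‖m‖ := heq ⟨hm0, by simpa using hm⟩
    rw [← hn, ← h, ← hypDist_zero_left hm, hd]

end Eigenfunction

end HypBall

theorem mainTheorem3 (k : ℕ) (hk : 1 ≤ k) (ρ : ℝ) (hρ : 0 < ρ)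
    (u : EuclideanSpace ℝ (Fin (k + 1))) (hu : ‖u‖ = ρ) (α μ : ℂ)
    (hμ : μ = (α * (k : ℂ) - α ^ 2) / (ρ : ℂ) ^ 2)
    (φ : ℝ → ℂ) (hφ : φ = fun r => HypBall.V k u α (ρ * Real.tanh (r / (2 * ρ)))) :
    -- the Euclidean radius in terms of the hyperbolic distance, so that `φ(r) = V_α(η(r))`
    (∀ m ∈ Metric.ball (0 : EuclideanSpace ℝ (Fin (k + 1))) ρ,
        ‖m‖ = ρ * Real.tanh (HypBall.hypDist ρ 0 m / (2 * ρ)) ∧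
        φ (HypBall.hypDist ρ 0 m) = HypBall.V k u α ‖m‖) ∧
    -- `φ` is a radial eigenfunction on the whole ball, with value `1` at the origin
    HypBall.IsRadialEigenfunctionOn k ρ μ (Metric.ball 0 ρ) φ ∧
    φ 0 = 1 ∧
    -- uniqueness, even if the equation is only required away from the origin
    (∀ ψ : ℝ → ℂ,
        HypBall.IsRadialEigenfunctionOn k ρ μ (Metric.ball 0 ρ \ {0}) ψ →
        ContinuousWithinAt ψ (Set.Ici 0) 0 →
        ψ 0 = 1 →
        ∀ r : ℝ, 0 ≤ r → ψ r = φ r) ∧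
    (∀ ψ : ℝ → ℂ,
        HypBall.IsRadialEigenfunctionOn k ρ μ (Metric.ball 0 ρ) ψ →
        ψ 0 = 1 →
        ∀ r : ℝ, 0 ≤ r → ψ r = φ r) := by
  subst hφ
  have hball : ∀ m ∈ Metric.ball (0 : EuclideanSpace ℝ (Fin (k + 1))) ρ,
      HypBall.V k u α (ρ * Real.tanh (HypBall.hypDist ρ 0 m / (2 * ρ))) = HypBall.V k u α ‖m‖ :=
    fun m hm => by rw [← HypBall.norm_eq_mul_tanh_hypDist hm]
  refine ⟨fun m hm => ⟨HypBall.norm_eq_mul_tanh_hypDist hm, hball m hm⟩, ?_, ?_, ?_, ?_⟩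
  · rw [HypBall.isRadialEigenfunctionOn_iff hk subset_rfl hball]
    refine ⟨HypBall.contDiffOn_V_norm hu hρ α, fun m hm => ?_⟩
    rw [HypBall.hypLaplacian_V_norm hk hu hm, hμ]
    ring
  · simp [HypBall.V_zero hu hρ]
  · intro ψ hψ hc h0 r hr
    refine HypBall.eq_V_of_isRadialEigenfunctionOn hk hρ hu hμ hψ h0 ?_ hr
    have hA : ContinuousAt (fun t => 2 * ρ * Real.artanh (t / ρ)) 0 :=
      (HypBall.hasDerivAt_two_mul_artanh_div (by simpa using hρ)).continuousAt
    -- Continuity of `ψ` at `0` is one-sided, so the change of variable must be seen to take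
    -- nonnegative values.
    have hA0 : Filter.Tendsto (fun t => 2 * ρ * Real.artanh (t / ρ)) (nhdsWithin 0 (Set.Ioi 0))
        (nhdsWithin 0 (Set.Ici 0)) := by
      refine tendsto_nhdsWithin_iff.2 ⟨?_, ?_⟩
      · simpa using hA.tendsto.mono_left nhdsWithin_le_nhds
      · filter_upwards [self_mem_nhdsWithin] with t ht
        have ht' : 0 < t := ht
        exact mul_nonneg (by positivity) (Real.artanh_nonneg (by positivity))
    have hψ1 := hc.tendsto
    rw [h0] at hψ1
    exact hψ1.comp hA0
  · intro ψ hψ h0 r hr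
    refine HypBall.eq_V_of_isRadialEigenfunctionOn hk hρ hu hμ
      ⟨hψ.1.mono Set.sdiff_subset, fun m hm => hψ.2 m hm.1⟩ h0 ?_ hr
    -- Continuity of `ψ` at `0` is not assumed here: it comes from `C²` regularity at the centre.
    have hg := ((HypBall.isRadialEigenfunctionOn_iff hk subset_rfl
      (g := fun t => ψ (2 * ρ * Real.artanh (t / ρ)))
      fun m hm => by rw [HypBall.hypDist_zero_left hm]).1 hψ).1
    simpa [h0] using HypBall.tendsto_of_continuousAt_comp_norm
      (f := fun t => ψ (2 * ρ * Real.artanh (t / ρ)))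
      (hg.continuousOn.continuousAt (Metric.ball_mem_nhds _ hρ))
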